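/- For $n\ge 0$ let $B^{(n)}=\mathbb F_2[X_1,\dots,X_n]/(X_1^2,\dots,X_n^2)$ with its grading $B^{(n)}=\bigoplus_k B^{(n)}_k$. For a homogeneous ideal $I$ of $B^{(n)}$, let $\operatorname{ind}(B^{(n)}/I)$ be the least $t\ge 0$ such that $(B^{(n)}/I)_k=0$ for all $k\ge t$. A sequence $\lambda_1,\dots,\lambda_m$ of nonzero homogeneous elements of $B^{(n)}$ of positive degree is of type $\mathbf d=(d_1,\dots,d_m)$ if $\deg\lambda_i=d_i$ for all $i$. It is semi-regular if, with $D=\operatorname{ind}\bigl(B^{(n)}/(\lambda_1,\dots,\lambda_m)\bigr)$, for every $i=1,\dots,m$ and every homogeneous $\mu$, the conditions $\mu\lambda_i\in(\lambda_1,\dots,\lambda_{i-1})$ and $\deg\mu+\deg\lambda_i<D$ imply $\mu\in(\lambda_1,\dots,\lambda_i)$. Let $\pi(n,\mathbf d)$ be the proportion of semi-regular sequences among all sequences of type $\mathbf d$ in $B^{(n)}$ (put $\pi(n,\mathbf d)=0$ if there are no sequences of type $\mathbf d$). For a real power series $a(z)=\sum_t a_tz^t$ let $\operatorname{ind}a(z)$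 be the first $t$ with $a_t\le 0$, and $\infty$ if there is none. Theorem. Let $\mathbf d=(d_1,\dots,d_m)$ be a vector of positive integers with $d_j\ge 2$ for some $j$. Then: 1. There is $N$ such that for all $n\ge N$ there is no semi-regular sequence of type $\mathbf d$ in $B^{(n)}$. 2. Consequently $\lim_{n\to\infty}\pi(n,\mathbf d)=0$; in particular the conjecture of Bardet, Faugère and Salvy, that $\lim_{n\to\infty}\pi(n,\mathbf e)=1$ for every $m$ and every vector $\mathbf e=(e_1,\dots,e_m)$ of positive integers, is false. 3. There are real numbers $r>\tfrac12$ and $c$, depending only on $\mathbf d$, such that for all $n\ge 0$ $$\operatorname{ind}\frac{(1+z)^n}{\prod_{i=1}^m(1+z^{d_i})}\ \ge\ rn+c .$$ In particular, for every $j$ this index is greater than $(n+d_j+2)/2$ for all sufficiently large $n$. -/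

import Mathlib

open Filter
open scoped Topology ENNReal

namespace SemiRegular

/-- The ideal `(X₁², …, Xₙ²)` of `𝔽₂[X₁, …, Xₙ]`. -/
noncomputable def squares (n : ℕ) : Ideal (MvPolynomial (Fin n) (ZMod 2)) :=
  Ideal.span (Set.range fun i : Fin n => (MvPolynomial.X i : MvPolynomial (Fin n) (ZMod 2)) ^ 2)

/-- The ring `B⁽ⁿ⁾ = 𝔽₂[X₁, …, Xₙ] / (X₁², …, Xₙ²)`. -/
abbrev B (n : ℕ) : Type := MvPolynomial (Fin n) (ZMod 2) ⧸ squares n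

/-- The graded piece `B⁽ⁿ⁾ₖ`: the image of the homogeneous polynomials of degree `k`
(zero included). -/
noncomputable def grade (n k : ℕ) : Submodule (ZMod 2) (B n) :=
  (MvPolynomial.homogeneousSubmodule (Fin n) (ZMod 2) k).map
    (Ideal.Quotient.mkₐ (ZMod 2) (squares n)).toLinearMap

/-- The index of `B⁽ⁿ⁾ / I` for a homogeneous ideal `I`: the least `t` such that the degree `k`
part of `B⁽ⁿ⁾ / I` vanishes for every `k ≥ t`. Such `t` exist, as `B⁽ⁿ⁾ₖ = 0` for `k > n`. -/
noncomputable def index {n : ℕ} (I : Ideal (B n)) : ℕ :=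
  sInf {t : ℕ | ∀ k, t ≤ k → ∀ b ∈ grade n k, b ∈ I}

/-- `lam 0, …, lam (m-1)` is a sequence of type `d`: each `lam i` is a (nonzero) homogeneous element
of degree `d i`. -/
def HasType {n m : ℕ} (d : Fin m → ℕ) (lam : Fin m → B n) : Prop :=
  ∀ i, lam i ∈ grade n (d i) ∧ lam i ≠ 0

/-- `D`-semi-regularity of a sequence of homogeneous elements of positive degree: whenever `mu` is
homogeneous, `mu * lam i ∈ (lam 0, …, lam (i-1))` and `deg mu + deg (lam i) < D`, one has
`mu ∈ (lam 0, …, lam i)`. -/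
def IsDSemiRegular {n m : ℕ} (D : ℕ) (lam : Fin m → B n) : Prop :=
  ∀ (i : Fin m) (e a : ℕ) (mu : B n), mu ∈ grade n e → lam i ∈ grade n a →
    mu * lam i ∈ Ideal.span (lam '' {j | j < i}) → e + a < D →
    mu ∈ Ideal.span (lam '' {j | j ≤ i})

/-- Semi-regularity: `D`-semi-regularity for `D` the index of the sequence. -/
def IsSemiRegular {n m : ℕ} (lam : Fin m → B n) : Prop :=
  IsDSemiRegular (index (Ideal.span (Set.range lam))) lam

/-- The proportion `π(n, m, d₁, …, dₘ)` of semi-regular sequences among all sequences of type `d`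
in `B⁽ⁿ⁾` (with value `0` when there is no sequence of type `d`, that is, when some `d i > n`). -/
noncomputable def proportion {m : ℕ} (d : Fin m → ℕ) (n : ℕ) : ℝ :=
  ({lam : Fin m → B n | HasType d lam ∧ IsSemiRegular lam}.ncard : ℝ) /
    ({lam : Fin m → B n | HasType d lam}.ncard : ℝ)

/-- The conjecture of Bardet, Faugère and Salvy: for every fixed `m` and `(d₁, …, dₘ)`, the
proportion of semi-regular sequences tends to `1` as the number of variables tends to infinity. -/
def BardetFaugereSalvyConjecture : Prop :=
  ∀ (m : ℕ) (d : Fin m → ℕ), (∀ i, 0 < d i) → Tendsto (proportion d) atTop (𝓝 1)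

/-- The index of a real power series: the first `t` whose coefficient is `≤ 0`, and `∞` if there is
none. -/
noncomputable def seriesIndex (a : PowerSeries ℝ) : ℕ∞ :=
  ⨅ (t : ℕ) (_ : PowerSeries.coeff t a ≤ 0), (t : ℕ∞)

/-- The series `(1 + z)ⁿ / ∏ᵢ (1 + z^{dᵢ})`. -/
noncomputable def hilbertQuotient {m : ℕ} (d : Fin m → ℕ) (n : ℕ) : PowerSeries ℝ :=
  (1 + PowerSeries.X) ^ n * (∏ i, (1 + PowerSeries.X ^ d i))⁻¹

end SemiRegular

/-!
# Semi-regular sequences of fixed type do not exist for large `n`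

Write `P(z) = ∏ᵢ (1 + z^{dᵢ})`. The proof plays two facts against each other.

*The index is large.* The coefficient of `z^t` in `(1 + z)ⁿ / P(z)` is positive for all `t ≤ r n`,
for some `r > 1/2` and all large `n` (`exists_coeff_hilbertQuotient_pos`). For small `t / n` the
leading term `C(n, t)` dominates. Otherwise, put `p = t / n`, `q = 1 - p` and `x = p / q`; after
tilting by `x`, the coefficient becomes, up to a positive factor, that of `(q + p z)ⁿ / R(z)` with
`R(z) = P(x z) / P(x)`. As `R(1) = 1`, one has `1 - R = (1 - z) w`, and `1 / R` is expanded in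
powers of `(1 - z) w`. Multiplication by `(1 - z)(q + p z)^K` is small, of order `K^{-1/2}`, in
the operator sense of `OpBound`, by the variance of the binomial distribution. Hence all terms but
the first add up to `O(1/n)` plus an exponentially small remainder
(`abs_coeff_bern_pow_mul_sub_le`), whereas the first one is the binomial probability of the mean,
at least `1 / (4 √n)` by Chebyshev's inequality (`le_coeff_bern_pow_mode`). The remainder stays
exponentially small for `x` slightly larger than `1`, and this is where `r > 1/2` comes from.

*A large index contradicts duality.* As squares of homogeneous elements of positive degree vanish,
the Hilbert series `H` of `B⁽ⁿ⁾ / I` satisfies `H(I) ≤ (1 + z^d) H(I + (a))` coefficientwise, with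
equality in the degrees where `a` is semi-regular modulo `I`. So for a semi-regular sequence of
index `D`, the series `P · H` equals `(1 + z)ⁿ` below degree `D` and is at least that in degree
`D`, whence the index of `(1 + z)ⁿ / P(z)` is at most `D` (`seriesIndex_le_of_isSemiRegular`). The
inequality, applied with any member `a` of degree `e` put first, also shows that `a` alone has
Hilbert series `(1 + z)ⁿ / (1 + z^e)` below degree `D` (`coeff_hilb_singleton`). Below degree
`D - e` the coefficients are the ranks of multiplication by `a`, and these are symmetric about
`(n - e) / 2` by Poincaré duality (`finrank_map_mul_eq`). If `D` exceeds `n / 2` by a constant,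
the symmetry holds on a full period of the recursion defined by `1 + z^e`, hence everywhere; then
`(1 + z)ⁿ / (1 + z^e)` is a polynomial, which forces `e = 1` (`not_symmetric_window`).
-/

namespace SemiRegular

section Algebra

/-! ### The basis of squarefree monomials -/

variable {n : ℕ}

/-- The exponent vector of the squarefree monomial `∏ i ∈ s, X i`. -/
noncomputable def sqfreeExp (s : Finset (Fin n)) : Fin n →₀ ℕ := ∑ i ∈ s, Finsupp.single i 1

lemma sqfreeExp_apply (s : Finset (Fin n)) (i : Fin n) :
    sqfreeExp s i = if i ∈ s then 1 else 0 := by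
  simp [sqfreeExp, Finsupp.finsetSum_apply, Finsupp.single_apply]

lemma sqfreeExp_injective : Function.Injective (sqfreeExp (n := n)) := by
  intro s t h
  ext i
  have := DFunLike.congr_fun h i
  rw [sqfreeExp_apply, sqfreeExp_apply] at this
  by_cases h1 : i ∈ s <;> by_cases h2 : i ∈ t <;> simp_all

lemma degree_sqfreeExp (s : Finset (Fin n)) : (sqfreeExp s).degree = s.card := by
  simp [Finsupp.degree_eq_sum, sqfreeExp_apply]

/-- The squares ideal consists of the polynomials without squarefree monomials. -/
lemma mem_squares_iff (p : MvPolynomial (Fin n) (ZMod 2)) :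
    p ∈ squares n ↔ ∀ s, p.coeff (sqfreeExp s) = 0 := by
  have h : squares n = Ideal.span ((fun e => MvPolynomial.monomial e (1 : ZMod 2)) ''
      (Set.range fun i : Fin n => Finsupp.single i 2)) := by
    rw [squares, ← Set.range_comp]
    congr 1
    ext p
    simp [MvPolynomial.X_pow_eq_monomial]
  rw [h, MvPolynomial.mem_ideal_span_monomial_image]
  constructor
  · intro h s
    by_contra hs
    obtain ⟨_, ⟨i, rfl⟩, hi⟩ := h _ (MvPolynomial.mem_support_iff.2 hs)
    have := hi i
    rw [sqfreeExp_apply] at this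
    simp at this
    split_ifs at this <;> omega
  · intro h e he
    by_contra! hcon
    apply MvPolynomial.mem_support_iff.1 he
    rw [show e = sqfreeExp e.support from ?_]
    · exact h _
    ext i
    rw [sqfreeExp_apply]
    have hi : ¬ (Finsupp.single i 2 ≤ e) := hcon _ ⟨i, rfl⟩
    rw [Finsupp.single_le_iff] at hi
    by_cases h0 : e i = 0
    · simp [h0]
    · simp [h0]; omega

/-- The squarefree monomial `∏ i ∈ s, X i` in `B⁽ⁿ⁾`. -/
noncomputable def mon (s : Finset (Fin n)) : B n :=
  Ideal.Quotient.mk (squares n) (MvPolynomial.monomial (sqfreeExp s) 1)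

lemma mkₐ_surjective (b : B n) : ∃ p, Ideal.Quotient.mkₐ (ZMod 2) (squares n) p = b :=
  Ideal.Quotient.mkₐ_surjective _ _ b

/-- The coefficients of squarefree monomials, as a linear map on polynomials. -/
noncomputable def coeffsAux (n : ℕ) :
    MvPolynomial (Fin n) (ZMod 2) →ₗ[ZMod 2] (Finset (Fin n) → ZMod 2) :=
  LinearMap.pi fun s => MvPolynomial.lcoeff (ZMod 2) (sqfreeExp s)

lemma coeffsAux_apply (p : MvPolynomial (Fin n) (ZMod 2)) (s : Finset (Fin n)) :
    coeffsAux n p s = p.coeff (sqfreeExp s) := rfl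

lemma coeffsAux_surjective : Function.Surjective (coeffsAux n) := by
  intro f
  refine ⟨∑ s, MvPolynomial.monomial (sqfreeExp s) (f s), ?_⟩
  ext t
  simp [coeffsAux_apply, MvPolynomial.coeff_sum, MvPolynomial.coeff_monomial,
    sqfreeExp_injective.eq_iff]

/-- `B⁽ⁿ⁾` as the space of functions on the squarefree monomials. The coefficients are read off from
a chosen representative; they do not depend on it, by `mem_squares_iff`. -/
noncomputable def coeffs (n : ℕ) : B n ≃ₗ[ZMod 2] (Finset (Fin n) → ZMod 2) := by
  refine LinearEquiv.ofBijective (IsLinearMap.mk' (fun b => coeffsAux n (mkₐ_surjective b).choose)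
    ?_) ?_
  all_goals
    have key : ∀ p : MvPolynomial (Fin n) (ZMod 2), coeffsAux n
        (mkₐ_surjective (Ideal.Quotient.mkₐ (ZMod 2) (squares n) p)).choose = coeffsAux n p := by
      intro p
      have := (mkₐ_surjective (Ideal.Quotient.mkₐ (ZMod 2) (squares n) p)).choose_spec
      have h2 := (Ideal.Quotient.mk_eq_mk_iff_sub_mem _ _).1 this
      rw [mem_squares_iff] at h2
      ext s
      rw [← sub_eq_zero, ← h2 s, MvPolynomial.coeff_sub]
      rfl
  · constructor
    · intro a b
      obtain ⟨p, rfl⟩ := mkₐ_surjective a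
      obtain ⟨q, rfl⟩ := mkₐ_surjective b
      rw [← map_add, key, key, key, map_add]
    · intro c a
      obtain ⟨p, rfl⟩ := mkₐ_surjective a
      rw [← map_smul, key, key, map_smul]
  · constructor
    · rw [← LinearMap.ker_eq_bot, LinearMap.ker_eq_bot']
      intro b hb
      obtain ⟨p, rfl⟩ := mkₐ_surjective b
      rw [IsLinearMap.mk'_apply, key] at hb
      exact Ideal.Quotient.eq_zero_iff_mem.2 ((mem_squares_iff p).2 fun s => congrFun hb s)
    · intro f
      obtain ⟨p, rfl⟩ := coeffsAux_surjective f
      exact ⟨Ideal.Quotient.mkₐ (ZMod 2) (squares n) p, by rw [IsLinearMap.mk'_apply, key]⟩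

lemma coeffs_mk (p : MvPolynomial (Fin n) (ZMod 2)) (s : Finset (Fin n)) :
    coeffs n (Ideal.Quotient.mk (squares n) p) s = p.coeff (sqfreeExp s) := by
  have := (mkₐ_surjective (Ideal.Quotient.mkₐ (ZMod 2) (squares n) p)).choose_spec
  have h2 := (Ideal.Quotient.mk_eq_mk_iff_sub_mem _ _).1 this
  rw [mem_squares_iff] at h2
  rw [← sub_eq_zero, ← h2 s, MvPolynomial.coeff_sub]
  rfl

lemma coeffs_mon (s t : Finset (Fin n)) : coeffs n (mon s) t = if s = t then 1 else 0 := by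
  rw [mon, coeffs_mk, MvPolynomial.coeff_monomial]
  simp [sqfreeExp_injective.eq_iff]

/-- The basis of `B⁽ⁿ⁾` given by the squarefree monomials. -/
noncomputable def monBasis (n : ℕ) : Module.Basis (Finset (Fin n)) (ZMod 2) (B n) :=
  Module.Basis.ofEquivFun (coeffs n)

lemma monBasis_apply (s : Finset (Fin n)) : monBasis n s = mon s := by
  apply (coeffs n).injective
  ext t
  rw [coeffs_mon, monBasis, Module.Basis.coe_ofEquivFun]
  simp [Pi.single_apply, eq_comm]

instance : Module.Finite (ZMod 2) (B n) := Module.Finite.of_basis (monBasis n)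

lemma mem_grade_iff {k : ℕ} {b : B n} :
    b ∈ grade n k ↔ ∀ s : Finset (Fin n), s.card ≠ k → coeffs n b s = 0 := by
  constructor
  · rintro ⟨p, hp, rfl⟩ s hs
    have : coeffs n ((Ideal.Quotient.mkₐ (ZMod 2) (squares n)).toLinearMap p) s =
      p.coeff (sqfreeExp s) := coeffs_mk p s
    rw [this]
    by_contra h
    have := (MvPolynomial.mem_homogeneousSubmodule _ _).1 hp h
    have hw : (sqfreeExp s).degree = k := by rw [Finsupp.degree_eq_weight_one]; exact this
    rw [degree_sqfreeExp] at hw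
    exact hs hw
  · intro h
    refine ⟨∑ s, MvPolynomial.monomial (sqfreeExp s) (coeffs n b s), ?_, ?_⟩
    · refine Submodule.sum_mem _ fun s _ => ?_
      by_cases hs : s.card = k
      · rw [MvPolynomial.mem_homogeneousSubmodule]
        exact MvPolynomial.isHomogeneous_monomial _ (by rw [degree_sqfreeExp, hs])
      · rw [h s hs]; simp
    · apply (coeffs n).injective
      ext t
      refine (coeffs_mk _ t).trans ?_
      simp [MvPolynomial.coeff_sum, MvPolynomial.coeff_monomial, sqfreeExp_injective.eq_iff]

lemma mon_mem_grade (s : Finset (Fin n)) : mon s ∈ grade n s.card := by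
  rw [mem_grade_iff]
  intro t ht
  rw [coeffs_mon, if_neg]
  rintro rfl; exact ht rfl

lemma mul_mem_grade {k l : ℕ} {a b : B n} (ha : a ∈ grade n k) (hb : b ∈ grade n l) :
    a * b ∈ grade n (k + l) := by
  obtain ⟨p, hp, rfl⟩ := ha
  obtain ⟨q, hq, rfl⟩ := hb
  exact ⟨p * q, MvPolynomial.IsHomogeneous.mul hp hq,
    map_mul (Ideal.Quotient.mkₐ (ZMod 2) (squares n)) _ _⟩

lemma grade_eq_span (k : ℕ) :
    grade n k = Submodule.span (ZMod 2) (monBasis n '' {s | s.card = k}) := by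
  ext b
  rw [mem_grade_iff, Module.Basis.mem_span_image]
  constructor
  · intro h s hs
    by_contra hk
    exact Finsupp.mem_support_iff.1 hs (h s hk)
  · intro h s hs
    by_contra hk
    exact hs (h (Finsupp.mem_support_iff.2 hk))

lemma finrank_grade (n k : ℕ) : Module.finrank (ZMod 2) (grade n k) = n.choose k := by
  rw [grade_eq_span, Set.image_eq_range]
  refine (finrank_span_eq_card ((monBasis n).linearIndependent.comp _
    (Subtype.val_injective (p := fun s : Finset (Fin n) => s.card = k)))).trans ?_
  rw [Fintype.card_subtype]
  have := Finset.card_powersetCard k (Finset.univ : Finset (Fin n))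
  rw [Finset.card_univ, Fintype.card_fin] at this
  rw [← this]
  congr 1
  ext s
  simp [Finset.mem_powersetCard]

lemma grade_eq_bot {k : ℕ} (h : n < k) : grade n k = ⊥ := by
  rw [← Submodule.finrank_eq_zero (R := ZMod 2), finrank_grade, Nat.choose_eq_zero_of_lt h]

/-- Squares of homogeneous elements of positive degree vanish, since squaring is additive. -/
lemma mul_self_eq_zero {k : ℕ} (hk : 0 < k) {b : B n} (hb : b ∈ grade n k) : b * b = 0 := by
  have hchar : ∀ c : B n, c + c = 0 := fun c => by
    have : (2 : ZMod 2) • c = 0 := by rw [show (2 : ZMod 2) = 0 from rfl, zero_smul]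
    rwa [two_smul] at this
  rw [grade_eq_span] at hb
  induction hb using Submodule.span_induction with
  | mem x hx =>
    obtain ⟨s, hs, rfl⟩ := hx
    rw [monBasis_apply, mon, ← map_mul, MvPolynomial.monomial_mul, Ideal.Quotient.eq_zero_iff_mem,
      mem_squares_iff]
    intro t
    rw [MvPolynomial.coeff_monomial, if_neg]
    intro h
    have hs' : s.Nonempty := by rw [← Finset.card_pos, hs]; exact hk
    obtain ⟨i, hi⟩ := hs'
    have := DFunLike.congr_fun h i
    rw [Finsupp.add_apply, sqfreeExp_apply, sqfreeExp_apply, if_pos hi] at this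
    split_ifs at this; omega
  | zero => simp
  | add x y _ _ hx hy =>
    have : (x + y) * (x + y) = x * x + y * y + (x * y + x * y) := by ring
    rw [this, hx, hy, hchar (x * y), add_zero, add_zero]
  | smul a x _ hx => rw [smul_mul_smul_comm, hx, smul_zero]

/-- Multiplication by a complementary monomial reads off a coefficient. -/
lemma coeffs_mul_mon_compl (b : B n) (s : Finset (Fin n)) :
    coeffs n (b * mon sᶜ) Finset.univ = coeffs n b s := by
  have hlin : ∀ b : B n, coeffs n (b * mon sᶜ) Finset.univ =
    ((LinearMap.proj Finset.univ).comp ((coeffs n).toLinearMap.comp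
      (LinearMap.mulRight (ZMod 2) (mon sᶜ)))) b := fun _ => rfl
  have hlin2 : ∀ b : B n, coeffs n b s =
    ((LinearMap.proj s).comp (coeffs n).toLinearMap) b := fun _ => rfl
  rw [hlin, hlin2]
  congr 1
  refine (monBasis n).ext fun t => ?_
  rw [← hlin, ← hlin2, monBasis_apply, coeffs_mon, mon, mon, ← map_mul, coeffs_mk,
    MvPolynomial.monomial_mul, MvPolynomial.coeff_monomial]
  have : sqfreeExp t + sqfreeExp sᶜ = sqfreeExp Finset.univ ↔ t = s := by
    constructor
    · intro h
      ext i
      have := DFunLike.congr_fun h i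
      rw [Finsupp.add_apply] at this
      simp only [sqfreeExp_apply, Finset.mem_compl, Finset.mem_univ, if_true] at this
      by_cases h1 : i ∈ s <;> by_cases h2 : i ∈ t <;> simp_all
    · rintro rfl
      ext i
      rw [Finsupp.add_apply]
      simp only [sqfreeExp_apply, Finset.mem_compl, Finset.mem_univ, if_true]
      by_cases h1 : i ∈ t <;> simp [h1]
  simp [this]

/-- Perfectness of the pairing `B⁽ⁿ⁾ₖ × B⁽ⁿ⁾ₗ → 𝔽₂`, `k + l = n`, given by the coefficient of
`X₁ ⋯ Xₙ` in the product. -/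
lemma eq_zero_of_pairing {k l : ℕ} (h : k + l = n) {b : B n} (hb : b ∈ grade n k)
    (h0 : ∀ c ∈ grade n l, coeffs n (b * c) Finset.univ = 0) : b = 0 := by
  apply (coeffs n).injective
  ext s
  rw [map_zero, Pi.zero_apply]
  by_cases hs : s.card = k
  · rw [← coeffs_mul_mon_compl]
    apply h0
    have := mon_mem_grade sᶜ
    rwa [Finset.card_compl, Fintype.card_fin, hs, show n - k = l by omega] at this
  · exact mem_grade_iff.1 hb s hs

/-! ### Poincaré duality -/

open Module in
lemma finrank_range_flip {K V W : Type*} [Field K] [AddCommGroup V] [Module K V]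
    [AddCommGroup W] [Module K W] [FiniteDimensional K W] (β : V →ₗ[K] W →ₗ[K] K) :
    finrank K (LinearMap.range β.flip) = finrank K (LinearMap.range β) := by
  have h : β.flip = β.dualMap ∘ₗ (evalEquiv K W).toLinearMap := by
    ext w v; rfl
  rw [h, LinearMap.range_comp_of_range_eq_top _ (LinearEquiv.range _)]
  exact LinearMap.finrank_range_dualMap_eq_finrank_range β

lemma finrank_map_add_finrank_inf_ker {K V W : Type*} [Field K] [AddCommGroup V] [Module K V]
    [AddCommGroup W] [Module K W] [FiniteDimensional K V] (f : V →ₗ[K] W) (p : Submodule K V) :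
    Module.finrank K (p.map f) + Module.finrank K (p ⊓ LinearMap.ker f : Submodule K V) =
      Module.finrank K p := by
  rw [← LinearMap.finrank_range_add_finrank_ker (f.domRestrict p), LinearMap.range_domRestrict,
    LinearMap.ker_domRestrict]
  congr 1
  rw [← Submodule.finrank_map_subtype_eq, Submodule.map_comap_subtype]

/-- Poincaré duality: multiplication by `b` of degree `d` has the same rank on `B⁽ⁿ⁾ₖ` as on
`B⁽ⁿ⁾ₗ` when `k + l + d = n`, the two maps being adjoint. -/
lemma finrank_map_mul_eq {k l d : ℕ} (h : k + l + d = n) {b : B n} (hb : b ∈ grade n d) :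
    Module.finrank (ZMod 2) ((grade n k).map (LinearMap.mulRight (ZMod 2) b)) =
      Module.finrank (ZMod 2) ((grade n l).map (LinearMap.mulRight (ZMod 2) b)) := by
  let top : B n →ₗ[ZMod 2] ZMod 2 := (LinearMap.proj Finset.univ).comp (coeffs n).toLinearMap
  let β : ∀ k l, grade n k →ₗ[ZMod 2] grade n l →ₗ[ZMod 2] ZMod 2 := fun k l =>
    (((LinearMap.mul (ZMod 2) (B n)).compr₂ top).comp
      ((LinearMap.mulRight (ZMod 2) b).domRestrict (grade n k))).compl₂ (grade n l).subtype
  have hβ : ∀ k l (x : grade n k) (y : grade n l),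
    β k l x y = coeffs n (x.1 * b * y.1) Finset.univ := fun _ _ _ _ => rfl
  have hker : ∀ k l, k + l + d = n → LinearMap.ker (β k l) =
      LinearMap.ker ((LinearMap.mulRight (ZMod 2) b).domRestrict (grade n k)) := by
    intro k l h
    ext x
    rw [LinearMap.mem_ker, LinearMap.mem_ker]
    constructor
    · intro hx
      refine eq_zero_of_pairing (k := k + d) (l := l) (by omega) (mul_mem_grade x.2 hb) ?_
      intro c hc
      have := hβ k l x ⟨c, hc⟩
      rw [hx] at this
      exact this.symm
    · intro hx
      ext y
      rw [hβ]
      change x.1 * b = 0 at hx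
      rw [hx]; simp
  have hrank : ∀ k l, k + l + d = n → Module.finrank (ZMod 2) (LinearMap.range (β k l)) =
      Module.finrank (ZMod 2) ((grade n k).map (LinearMap.mulRight (ZMod 2) b)) := by
    intro k l h
    rw [← LinearMap.range_domRestrict]
    have h1 := LinearMap.finrank_range_add_finrank_ker (β k l)
    have h2 := LinearMap.finrank_range_add_finrank_ker
      ((LinearMap.mulRight (ZMod 2) b).domRestrict (grade n k))
    rw [hker k l h] at h1
    omega
  rw [← hrank k l h, ← hrank l k (by omega), ← finrank_range_flip]
  rw [show (β k l).flip = β l k from ?_]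
  ext x y
  rw [LinearMap.flip_apply, hβ, hβ, show y.1 * b * x.1 = x.1 * b * y.1 by ring]

/-! ### Homogeneous ideals -/

/-- The projection of `B⁽ⁿ⁾` onto its graded piece of degree `k`. -/
noncomputable def gradeProj (n k : ℕ) : B n →ₗ[ZMod 2] B n :=
  (coeffs n).symm.toLinearMap ∘ₗ
    (LinearMap.pi fun s => if s.card = k then LinearMap.proj s else 0) ∘ₗ (coeffs n).toLinearMap

lemma coeffs_gradeProj (k : ℕ) (b : B n) (s : Finset (Fin n)) :
    coeffs n (gradeProj n k b) s = if s.card = k then coeffs n b s else 0 := by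
  simp only [gradeProj, LinearMap.comp_apply, LinearEquiv.coe_coe, LinearEquiv.apply_symm_apply,
    LinearMap.pi_apply]
  split_ifs <;> rfl

lemma gradeProj_mem (k : ℕ) (b : B n) : gradeProj n k b ∈ grade n k := by
  rw [mem_grade_iff]
  intro s hs
  rw [coeffs_gradeProj, if_neg hs]

lemma gradeProj_of_mem {k : ℕ} {b : B n} (hb : b ∈ grade n k) (l : ℕ) :
    gradeProj n l b = if k = l then b else 0 := by
  apply (coeffs n).injective
  ext s
  rw [coeffs_gradeProj]
  rw [mem_grade_iff] at hb
  by_cases h : k = l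
  · subst h
    rw [if_pos rfl]
    split_ifs with h
    · rfl
    · exact (hb s h).symm
  · rw [if_neg h, map_zero, Pi.zero_apply]
    split_ifs with h'
    · exact hb s (by omega)
    · rfl

lemma gradeProj_mul {d : ℕ} {a : B n} (ha : a ∈ grade n d) (b : B n) (k : ℕ) :
    gradeProj n k (b * a) = if d ≤ k then gradeProj n (k - d) b * a else 0 := by
  have key : gradeProj n k ∘ₗ LinearMap.mulRight (ZMod 2) a = if d ≤ k then
      LinearMap.mulRight (ZMod 2) a ∘ₗ gradeProj n (k - d) else 0 := by
    refine (monBasis n).ext fun s => ?_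
    rw [monBasis_apply, LinearMap.comp_apply, LinearMap.mulRight_apply,
      gradeProj_of_mem (mul_mem_grade (mon_mem_grade s) ha)]
    by_cases h : d ≤ k
    · rw [if_pos h, LinearMap.comp_apply, gradeProj_of_mem (mon_mem_grade s),
        LinearMap.mulRight_apply]
      by_cases h' : s.card + d = k
      · rw [if_pos h', if_pos (by omega)]
      · rw [if_neg h', if_neg (by omega), zero_mul]
    · rw [if_neg h, if_neg (by omega), LinearMap.zero_apply]
  have := LinearMap.congr_fun key b
  rw [LinearMap.comp_apply, LinearMap.mulRight_apply] at this
  rw [this]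
  split_ifs <;> rfl

/-- An ideal of `B⁽ⁿ⁾` is homogeneous if it contains the homogeneous components of its elements. -/
def IsHomog (I : Ideal (B n)) : Prop := ∀ k, ∀ b ∈ I, gradeProj n k b ∈ I

lemma isHomog_bot : IsHomog (⊥ : Ideal (B n)) := by
  intro k b hb
  rw [Ideal.mem_bot] at hb ⊢
  rw [hb, map_zero]

lemma IsHomog.sup {I J : Ideal (B n)} (hI : IsHomog I) (hJ : IsHomog J) : IsHomog (I ⊔ J) := by
  intro k b hb
  obtain ⟨x, hx, y, hy, rfl⟩ := Submodule.mem_sup.1 hb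
  rw [map_add]
  exact Submodule.add_mem_sup (hI k x hx) (hJ k y hy)

lemma isHomog_span_singleton {d : ℕ} {a : B n} (ha : a ∈ grade n d) :
    IsHomog (Ideal.span {a}) := by
  intro k b hb
  obtain ⟨c, rfl⟩ := Ideal.mem_span_singleton'.1 hb
  rw [gradeProj_mul ha]
  split_ifs
  · exact Ideal.mul_mem_left _ _ (Ideal.mem_span_singleton_self a)
  · exact Ideal.zero_mem _

/-- The degree `k` part of an ideal. -/
noncomputable def idealGrade (I : Ideal (B n)) (k : ℕ) : Submodule (ZMod 2) (B n) :=
  grade n k ⊓ I.restrictScalars (ZMod 2)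

lemma mem_idealGrade {I : Ideal (B n)} {k : ℕ} {b : B n} :
    b ∈ idealGrade I k ↔ b ∈ grade n k ∧ b ∈ I := Iff.rfl

lemma idealGrade_sup_of_lt {I : Ideal (B n)} (hI : IsHomog I) {d k : ℕ} {a : B n}
    (ha : a ∈ grade n d) (hk : k < d) :
    idealGrade (I ⊔ Ideal.span {a}) k = idealGrade I k := by
  ext b
  rw [mem_idealGrade, mem_idealGrade]
  refine and_congr_right fun hb => ⟨fun h => ?_, fun h => Ideal.mem_sup_left h⟩
  rw [sup_comm] at h
  obtain ⟨c, x, hx, rfl⟩ := Ideal.mem_span_singleton_sup.1 h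
  have := gradeProj_of_mem hb k
  rw [if_pos rfl, map_add, gradeProj_mul ha, if_neg (by omega), zero_add] at this
  rw [← this]
  exact hI k x hx

lemma idealGrade_sup_add {I : Ideal (B n)} (hI : IsHomog I) {d : ℕ} {a : B n}
    (ha : a ∈ grade n d) (k : ℕ) :
    idealGrade (I ⊔ Ideal.span {a}) (k + d) =
      idealGrade I (k + d) ⊔ (grade n k).map (LinearMap.mulRight (ZMod 2) a) := by
  apply le_antisymm
  · rintro b ⟨hb, h⟩
    rw [sup_comm] at h
    obtain ⟨c, x, hx, rfl⟩ := Ideal.mem_span_singleton_sup.1 h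
    have := gradeProj_of_mem hb (k + d)
    rw [if_pos rfl, map_add, gradeProj_mul ha, if_pos (by omega), Nat.add_sub_cancel,
      add_comm] at this
    rw [← this]
    exact Submodule.add_mem_sup ⟨gradeProj_mem _ _, hI _ x hx⟩ ⟨_, gradeProj_mem _ _, rfl⟩
  · refine sup_le (fun b hb => ⟨hb.1, Ideal.mem_sup_left hb.2⟩) ?_
    rintro _ ⟨c, hc, rfl⟩
    exact ⟨mul_mem_grade hc ha, Ideal.mem_sup_right
      (Ideal.mul_mem_left _ _ (Ideal.mem_span_singleton_self a))⟩

/-- The elements of degree `k` which `a` multiplies into `I`. -/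
noncomputable def colonGrade (I : Ideal (B n)) (a : B n) (k : ℕ) : Submodule (ZMod 2) (B n) :=
  grade n k ⊓ (I.restrictScalars (ZMod 2)).comap (LinearMap.mulRight (ZMod 2) a)

lemma finrank_idealGrade_sup {I : Ideal (B n)} (hI : IsHomog I) {d : ℕ} {a : B n}
    (ha : a ∈ grade n d) (k : ℕ) :
    Module.finrank (ZMod 2) (idealGrade (I ⊔ Ideal.span {a}) (k + d)) +
        Module.finrank (ZMod 2) (colonGrade I a k) =
      Module.finrank (ZMod 2) (idealGrade I (k + d)) + n.choose k := by
  set f := LinearMap.mulRight (ZMod 2) a with hf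
  have hmap : (colonGrade I a k).map f = idealGrade I (k + d) ⊓ (grade n k).map f := by
    ext b
    constructor
    · rintro ⟨c, hc, rfl⟩
      exact ⟨⟨mul_mem_grade hc.1 ha, hc.2⟩, ⟨c, hc.1, rfl⟩⟩
    · rintro ⟨⟨_, hb⟩, c, hc, rfl⟩
      exact ⟨c, ⟨hc, hb⟩, rfl⟩
  have hker : colonGrade I a k ⊓ LinearMap.ker f = grade n k ⊓ LinearMap.ker f := by
    apply le_antisymm
    · exact inf_le_inf_right _ inf_le_left
    · rintro c ⟨hc, hc'⟩
      refine ⟨⟨hc, ?_⟩, hc'⟩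
      change f c ∈ I
      rw [LinearMap.mem_ker.1 hc']
      exact Ideal.zero_mem _
  have h1 := Submodule.finrank_sup_add_finrank_inf_eq (idealGrade I (k + d)) ((grade n k).map f)
  have h2 := finrank_map_add_finrank_inf_ker f (colonGrade I a k)
  have h3 := finrank_map_add_finrank_inf_ker f (grade n k)
  rw [hker, hmap] at h2
  rw [← idealGrade_sup_add hI ha] at h1
  rw [finrank_grade] at h3
  omega

/-- As `a² = 0`, the ideal `I + (a)` is contained in `(I : a)`. -/
lemma idealGrade_sup_le_colonGrade (I : Ideal (B n)) {d : ℕ} (hd : 0 < d) {a : B n}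
    (ha : a ∈ grade n d) (k : ℕ) : idealGrade (I ⊔ Ideal.span {a}) k ≤ colonGrade I a k := by
  rintro b ⟨hb, h⟩
  refine ⟨hb, ?_⟩
  rw [sup_comm] at h
  obtain ⟨c, x, hx, rfl⟩ := Ideal.mem_span_singleton_sup.1 h
  change (c * a + x) * a ∈ I
  rw [add_mul, mul_assoc, mul_self_eq_zero hd ha, mul_zero, zero_add]
  exact Ideal.mul_mem_right _ _ hx

/-! ### Hilbert series -/

/-- The Hilbert series of `B⁽ⁿ⁾ / I`, for a homogeneous ideal `I`. -/
noncomputable def hilb (I : Ideal (B n)) : PowerSeries ℝ :=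
  PowerSeries.mk fun k => (n.choose k : ℝ) - Module.finrank (ZMod 2) (idealGrade I k)

lemma coeff_hilb (I : Ideal (B n)) (k : ℕ) : PowerSeries.coeff k (hilb I) =
    (n.choose k : ℝ) - Module.finrank (ZMod 2) (idealGrade I k) := PowerSeries.coeff_mk _ _

lemma coeff_one_add_X_pow (n k : ℕ) :
    PowerSeries.coeff k ((1 + PowerSeries.X) ^ n : PowerSeries ℝ) = n.choose k := by
  have h := Polynomial.coeff_one_add_X_pow ℝ n k
  rw [← Polynomial.coeff_coe] at h
  simpa using h

lemma hilb_bot : hilb (⊥ : Ideal (B n)) = (1 + PowerSeries.X) ^ n := by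
  ext k
  have : idealGrade (⊥ : Ideal (B n)) k = ⊥ := by
    rw [eq_bot_iff]
    exact fun b hb => hb.2
  rw [coeff_hilb, coeff_one_add_X_pow, this]
  simp

lemma coeff_one_add_X_pow_mul (d k : ℕ) (F : PowerSeries ℝ) :
    PowerSeries.coeff k ((1 + PowerSeries.X ^ d) * F) =
      PowerSeries.coeff k F + if d ≤ k then PowerSeries.coeff (k - d) F else 0 := by
  rw [add_mul, one_mul, map_add, PowerSeries.coeff_X_pow_mul']

lemma coeff_hilb_le {I : Ideal (B n)} (hI : IsHomog I) {d : ℕ} (hd : 0 < d) {a : B n}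
    (ha : a ∈ grade n d) (k : ℕ) : PowerSeries.coeff k (hilb I) ≤
      PowerSeries.coeff k ((1 + PowerSeries.X ^ d) * hilb (I ⊔ Ideal.span {a})) := by
  rw [coeff_one_add_X_pow_mul]
  split_ifs with h
  · obtain ⟨k, rfl⟩ := Nat.exists_eq_add_of_le' h
    rw [Nat.add_sub_cancel, coeff_hilb, coeff_hilb, coeff_hilb]
    have h1 := finrank_idealGrade_sup hI ha k
    have h2 := Submodule.finrank_mono (idealGrade_sup_le_colonGrade I hd ha k)
    have h1' : (_ : ℝ) = _ := congrArg Nat.cast h1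
    have h2' : (_ : ℝ) ≤ _ := Nat.cast_le.2 h2
    push_cast at h1' h2'
    linarith
  · rw [coeff_hilb, coeff_hilb, idealGrade_sup_of_lt hI ha (by omega), add_zero]

lemma coeff_hilb_eq {I : Ideal (B n)} (hI : IsHomog I) {d : ℕ} (hd : 0 < d) {a : B n}
    (ha : a ∈ grade n d) {k : ℕ}
    (hreg : d ≤ k → ∀ mu ∈ grade n (k - d), mu * a ∈ I → mu ∈ I ⊔ Ideal.span {a}) :
    PowerSeries.coeff k ((1 + PowerSeries.X ^ d) * hilb (I ⊔ Ideal.span {a})) =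
      PowerSeries.coeff k (hilb I) := by
  rw [coeff_one_add_X_pow_mul]
  split_ifs with h
  · obtain ⟨k, rfl⟩ := Nat.exists_eq_add_of_le' h
    specialize hreg h
    rw [Nat.add_sub_cancel] at hreg ⊢
    rw [coeff_hilb, coeff_hilb, coeff_hilb]
    have h1 := finrank_idealGrade_sup hI ha k
    have h2 : idealGrade (I ⊔ Ideal.span {a}) k = colonGrade I a k :=
      le_antisymm (idealGrade_sup_le_colonGrade I hd ha k) fun b hb => ⟨hb.1, hreg b hb.1 hb.2⟩
    rw [← h2] at h1
    have h1' : (_ : ℝ) = _ := congrArg Nat.cast h1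
    push_cast at h1'
    linarith
  · rw [coeff_hilb, coeff_hilb, idealGrade_sup_of_lt hI ha (by omega), add_zero]

lemma mem_of_index_le {I : Ideal (B n)} {k : ℕ} (hk : index I ≤ k) {b : B n}
    (hb : b ∈ grade n k) : b ∈ I := by
  have hne : {t : ℕ | ∀ k, t ≤ k → ∀ b ∈ grade n k, b ∈ I}.Nonempty := by
    refine ⟨n + 1, fun k hk b hb => ?_⟩
    rw [grade_eq_bot (by omega)] at hb
    rw [(Submodule.mem_bot _).1 hb]
    exact Ideal.zero_mem _
  exact Nat.sInf_mem hne k hk b hb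

lemma coeff_hilb_of_index_le {I : Ideal (B n)} {k : ℕ} (hk : index I ≤ k) :
    PowerSeries.coeff k (hilb I) = 0 := by
  have : idealGrade I k = grade n k :=
    le_antisymm inf_le_left fun b hb => ⟨hb, mem_of_index_le hk hb⟩
  rw [coeff_hilb, this, finrank_grade, sub_self]

/-! ### Hilbert series of semi-regular sequences -/

/-- The denominator `∏ᵢ (1 + z^{dᵢ})`, over a finite set of indices. -/
noncomputable def denom {ι : Type*} (d : ι → ℕ) (T : Finset ι) : PowerSeries ℝ :=
  ∏ i ∈ T, (1 + PowerSeries.X ^ d i)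

lemma constantCoeff_denom {ι : Type*} {d : ι → ℕ} (hd : ∀ i, 0 < d i) (T : Finset ι) :
    PowerSeries.constantCoeff (denom d T) = 1 := by
  rw [denom, map_prod]
  refine Finset.prod_eq_one fun i _ => ?_
  simp [(hd i).ne']

lemma denom_insert {ι : Type*} [DecidableEq ι] (d : ι → ℕ) {T : Finset ι} {i : ι} (hi : i ∉ T) :
    denom d (insert i T) = (1 + PowerSeries.X ^ d i) * denom d T := Finset.prod_insert hi

lemma coeff_one_add_X_pow_mul_mono (d : ℕ) {F G : PowerSeries ℝ}
    (h : ∀ k, PowerSeries.coeff k F ≤ PowerSeries.coeff k G) (k : ℕ) :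
    PowerSeries.coeff k ((1 + PowerSeries.X ^ d) * F) ≤
      PowerSeries.coeff k ((1 + PowerSeries.X ^ d) * G) := by
  rw [coeff_one_add_X_pow_mul, coeff_one_add_X_pow_mul]
  have h1 := h k
  have h2 := h (k - d)
  split_ifs <;> linarith

lemma coeff_denom_mul_mono {ι : Type*} (d : ι → ℕ) (T : Finset ι) {F G : PowerSeries ℝ}
    (h : ∀ k, PowerSeries.coeff k F ≤ PowerSeries.coeff k G) (k : ℕ) :
    PowerSeries.coeff k (denom d T * F) ≤ PowerSeries.coeff k (denom d T * G) := by
  classical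
  induction T using Finset.induction_on generalizing k with
  | empty => simpa [denom] using h k
  | insert i T hi ih =>
    rw [denom_insert d hi, mul_assoc, mul_assoc]
    exact coeff_one_add_X_pow_mul_mono _ ih k

variable {m : ℕ} {d : Fin m → ℕ} {lam : Fin m → B n}

lemma isHomog_span_image (hlam : ∀ i, lam i ∈ grade n (d i)) (T : Finset (Fin m)) :
    IsHomog (Ideal.span (lam '' T)) := by
  induction T using Finset.induction_on with
  | empty => simpa using isHomog_bot
  | insert i T hi ih =>
    rw [Finset.coe_insert, Set.image_insert_eq, Ideal.span_insert]
    exact (isHomog_span_singleton (hlam i)).sup ih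

lemma coeff_hilb_le_denom_mul (hd : ∀ i, 0 < d i) (hlam : ∀ i, lam i ∈ grade n (d i))
    {I : Ideal (B n)} (hI : IsHomog I) (T : Finset (Fin m)) (k : ℕ) :
    PowerSeries.coeff k (hilb I) ≤
      PowerSeries.coeff k (denom d T * hilb (I ⊔ Ideal.span (lam '' T))) := by
  induction T using Finset.induction_on generalizing k with
  | empty => simp [denom]
  | insert i T hi ih =>
    refine (ih k).trans ?_
    rw [denom_insert d hi, mul_comm (1 + _), mul_assoc]
    refine coeff_denom_mul_mono d T (fun k => ?_) k
    rw [Finset.coe_insert, Set.image_insert_eq, Ideal.span_insert, sup_comm (Ideal.span {lam i}),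
      ← sup_assoc]
    exact coeff_hilb_le (hI.sup (isHomog_span_image hlam T)) (hd i) (hlam i) k

/-- The Hilbert series of a semi-regular sequence of index `D` agrees with
`(1 + z)ⁿ / ∏ᵢ (1 + z^{dᵢ})` in degrees below `D`. -/
lemma X_pow_dvd_of_isDSemiRegular (hd : ∀ i, 0 < d i) (hlam : ∀ i, lam i ∈ grade n (d i)) {D : ℕ}
    (h : IsDSemiRegular D lam) : PowerSeries.X ^ D ∣
      denom d Finset.univ * hilb (Ideal.span (Set.range lam)) - (1 + PowerSeries.X) ^ n := by
  -- induction over the initial segments of the sequence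
  have key : ∀ j : ℕ, j ≤ m → PowerSeries.X ^ D ∣
      denom d (Finset.univ.filter fun i : Fin m => i.1 < j) *
        hilb (Ideal.span (lam '' (Finset.univ.filter fun i : Fin m => i.1 < j : Finset (Fin m)))) -
      (1 + PowerSeries.X) ^ n := by
    intro j
    induction j with
    | zero =>
      intro _
      simp [denom, hilb_bot]
    | succ j ih =>
      intro hj
      set i : Fin m := ⟨j, hj⟩ with hi
      have hT : (Finset.univ.filter fun i : Fin m => i.1 < j + 1) =
          insert i (Finset.univ.filter fun i : Fin m => i.1 < j) := by
        ext a
        simp only [Finset.mem_filter, Finset.mem_univ, true_and, Finset.mem_insert, hi, Fin.ext_iff]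
        omega
      have hni : i ∉ Finset.univ.filter fun i : Fin m => i.1 < j := by simp [hi]
      set T := Finset.univ.filter fun i : Fin m => i.1 < j with hTdef
      have hlt : ((T : Finset (Fin m)) : Set (Fin m)) = {a | a < i} := by
        ext a; simp [hTdef, hi, Fin.lt_def]
      have hle : ((insert i T : Finset (Fin m)) : Set (Fin m)) = {a | a ≤ i} := by
        ext a
        simp [hTdef, hi, Fin.le_def, Fin.ext_iff]; omega
      have hstep : PowerSeries.X ^ D ∣ (1 + PowerSeries.X ^ d i) *
          hilb (Ideal.span (lam '' (insert i T : Finset (Fin m)))) -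
            hilb (Ideal.span (lam '' T)) := by
        rw [PowerSeries.X_pow_dvd_iff]
        intro k hk
        rw [map_sub, sub_eq_zero]
        have hspan : Ideal.span (lam '' (insert i T : Finset (Fin m))) =
            Ideal.span (lam '' T) ⊔ Ideal.span {lam i} := by
          rw [Finset.coe_insert, Set.image_insert_eq, Ideal.span_insert, sup_comm]
        rw [hspan]
        refine coeff_hilb_eq (isHomog_span_image hlam T) (hd i) (hlam i) fun hdk mu hmu hmem => ?_
        rw [← hspan, hle]
        refine h i (k - d i) (d i) mu hmu (hlam i) ?_ (by omega)
        rwa [← hlt]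
      rw [hT, denom_insert d hni]
      have h1 := ih (by omega)
      have h2 := dvd_add (hstep.mul_left (denom d T)) h1
      convert h2 using 1
      ring
  have := key m le_rfl
  have hu : (Finset.univ.filter fun i : Fin m => i.1 < m) = Finset.univ := by
    ext i; simp
  rwa [hu, Finset.coe_univ, Set.image_univ] at this

/-- The index of the series bounds the index of a semi-regular sequence from below. -/
lemma seriesIndex_le_of_isSemiRegular (hd : ∀ i, 0 < d i) (hlam : ∀ i, lam i ∈ grade n (d i))
    (h : IsSemiRegular lam) :
    seriesIndex (hilbertQuotient d n) ≤ index (Ideal.span (Set.range lam)) := by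
  set D := index (Ideal.span (Set.range lam)) with hD
  obtain ⟨E, hE⟩ := X_pow_dvd_of_isDSemiRegular hd hlam h
  have hinv : denom d Finset.univ * (denom d Finset.univ)⁻¹ = 1 :=
    PowerSeries.mul_inv_cancel _ (by rw [constantCoeff_denom hd]; exact one_ne_zero)
  have hq : hilbertQuotient d n = hilb (Ideal.span (Set.range lam)) -
      PowerSeries.X ^ D * (E * (denom d Finset.univ)⁻¹) := by
    rw [← mul_assoc, ← hE, sub_mul, mul_right_comm, hinv, one_mul, sub_sub_cancel]
    rfl
  -- `E` collects the excess in degrees at least `D`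
  have hE0 : 0 ≤ PowerSeries.constantCoeff E := by
    have h1 := coeff_hilb_le_denom_mul hd hlam isHomog_bot Finset.univ D
    rw [bot_sup_eq, hilb_bot, Finset.coe_univ, Set.image_univ, ← sub_nonneg, ← map_sub, hE,
      PowerSeries.coeff_X_pow_mul', if_pos le_rfl, Nat.sub_self] at h1
    simpa using h1
  refine iInf₂_le D ?_
  rw [hq, map_sub, coeff_hilb_of_index_le hD.ge, PowerSeries.coeff_X_pow_mul', if_pos le_rfl,
    Nat.sub_self, PowerSeries.coeff_zero_eq_constantCoeff_apply, map_mul,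
    PowerSeries.constantCoeff_inv, constantCoeff_denom hd]
  simpa using hE0

/-- Each member of a semi-regular sequence is by itself semi-regular in degrees below the index:
the Hilbert series of `B⁽ⁿ⁾ / (lam j)` is squeezed between its extreme values. -/
lemma coeff_hilb_singleton (hd : ∀ i, 0 < d i) (hlam : ∀ i, lam i ∈ grade n (d i)) {D : ℕ}
    (h : IsDSemiRegular D lam) (j : Fin m) {k : ℕ} (hk : k < D) :
    PowerSeries.coeff k ((1 + PowerSeries.X ^ d j) * hilb (Ideal.span {lam j})) =
      (n.choose k : ℝ) := by
  apply le_antisymm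
  · have h1 := PowerSeries.X_pow_dvd_iff.1 (X_pow_dvd_of_isDSemiRegular hd hlam h) k hk
    rw [map_sub, sub_eq_zero, coeff_one_add_X_pow] at h1
    rw [← h1]
    have hu : Finset.univ = insert j (Finset.univ.erase j) := by simp
    have hspan : Ideal.span (Set.range lam) =
        Ideal.span {lam j} ⊔ Ideal.span (lam '' (Finset.univ.erase j : Finset (Fin m))) := by
      rw [← Ideal.span_insert, ← Set.image_insert_eq, ← Finset.coe_insert, ← hu, Finset.coe_univ,
        Set.image_univ]
    rw [hspan, hu, denom_insert d (Finset.notMem_erase j _), mul_assoc, ← hu]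
    exact coeff_one_add_X_pow_mul_mono _
      (coeff_hilb_le_denom_mul hd hlam (isHomog_span_singleton (hlam j)) _) k
  · have h1 := coeff_hilb_le isHomog_bot (hd j) (hlam j) k
    rwa [bot_sup_eq, hilb_bot, coeff_one_add_X_pow] at h1

/-! ### Duality against semi-regularity -/

lemma coeff_hilb_singleton_add (hlam : ∀ i, lam i ∈ grade n (d i))
    (j : Fin m) (k : ℕ) : PowerSeries.coeff (k + d j) (hilb (Ideal.span {lam j})) =
      (n.choose (k + d j) : ℝ) - Module.finrank (ZMod 2)
        ((grade n k).map (LinearMap.mulRight (ZMod 2) (lam j))) := by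
  have h1 := idealGrade_sup_add isHomog_bot (hlam j) k
  have h2 : idealGrade (⊥ : Ideal (B n)) (k + d j) = ⊥ := by
    rw [eq_bot_iff]
    exact fun b hb => hb.2
  rw [bot_sup_eq, h2, bot_sup_eq] at h1
  rw [coeff_hilb, h1]

/-- Poincaré duality makes the Hilbert series of `B⁽ⁿ⁾ / (lam j)` symmetric about `(n - d j) / 2`
in the degrees governed by semi-regularity. -/
lemma coeff_hilb_singleton_symm (hd : ∀ i, 0 < d i) (hlam : ∀ i, lam i ∈ grade n (d i)) {D : ℕ}
    (h : IsDSemiRegular D lam) (j : Fin m) {k l : ℕ} (hkl : k + l + d j = n) (hk : k + d j < D)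
    (hl : l + d j < D) : PowerSeries.coeff k (hilb (Ideal.span {lam j})) =
      PowerSeries.coeff l (hilb (Ideal.span {lam j})) := by
  have h1 := coeff_hilb_singleton hd hlam h j hk
  have h2 := coeff_hilb_singleton hd hlam h j hl
  rw [coeff_one_add_X_pow_mul, if_pos (by omega), Nat.add_sub_cancel,
    coeff_hilb_singleton_add hlam] at h1 h2
  rw [finrank_map_mul_eq hkl (hlam j)] at h1
  linarith

/-- A solution of the recursion `F k + F (k - e) = C(n, k)`, with `F k = C(n, k)` for `k < e`,
which is symmetric about `(n - e) / 2` on a full period, gives a polynomial cofactor of `1 + z ^ e`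
in `(1 + z) ^ n`, so that `e = 1`. -/
lemma not_symmetric_window {n e : ℕ} (he : 2 ≤ e) (hen : e ≤ n) (F : ℕ → ℝ)
    (hF0 : ∀ k < e, F k = n.choose k) (hF : ∀ k, F (k + e) + F k = n.choose (k + e)) {k₀ : ℕ}
    (hk₀ : k₀ + 2 * e ≤ n + 1)
    (hsymm : ∀ k, k₀ ≤ k → k < k₀ + e → F k = F (n - e - k)) : False := by
  -- the recursion propagates the symmetry, upwards and downwards, by steps of `e`
  have hstep : ∀ k, k + e + e ≤ n → (F k = F (n - e - k) ↔ F (k + e) = F (n - e - (k + e))) := by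
    intro k hk
    have h1 := hF k
    have h2 := hF (n - e - (k + e))
    rw [show n - e - (k + e) + e = n - e - k by omega] at h2
    have h3 : n.choose (n - e - k) = n.choose (k + e) := by
      rw [← Nat.choose_symm (show k + e ≤ n by omega)]; congr 1; omega
    rw [h3] at h2
    constructor <;> intro h <;> linarith
  have hup : ∀ k, k₀ ≤ k → k + e ≤ n → F k = F (n - e - k) := by
    intro k
    induction k using Nat.strong_induction_on with
    | _ k ih =>
      intro h1 h2
      by_cases h : k < k₀ + e
      · exact hsymm k h1 h
      · have := (hstep (k - e) (by omega)).1 (ih (k - e) (by omega) (by omega) (by omega))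
        rwa [show k - e + e = k by omega] at this
  have hall : ∀ k, k + e ≤ n → F k = F (n - e - k) := by
    have : ∀ j k, k₀ ≤ k + j → k + e ≤ n → F k = F (n - e - k) := by
      intro j
      induction j using Nat.strong_induction_on with
      | _ j ih =>
        intro k h1 h2
        by_cases h : k₀ ≤ k
        · exact hup k h h2
        · by_cases hj : e ≤ j
          · exact (hstep k (by omega)).2 (ih (j - e) (by omega) (k + e) (by omega) (by omega))
          · exact (hstep k (by omega)).2 (hup (k + e) (by omega) (by omega))
    intro k hk
    exact this k₀ k (by omega) hk
  -- hence `F` vanishes beyond `n - e`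
  have hzero : ∀ k, n < k + e → F k = 0 := by
    intro k
    induction k using Nat.strong_induction_on with
    | _ k ih =>
      intro hk
      by_cases hke : k < e
      · omega
      · have h1 := hF (k - e)
        rw [show k - e + e = k by omega] at h1
        by_cases hkn : k ≤ n
        · have h2 := hall (k - e) (by omega)
          rw [show n - e - (k - e) = n - k by omega, hF0 (n - k) (by omega),
            Nat.choose_symm hkn] at h2
          linarith
        · rw [ih (k - e) (by omega) (by omega), Nat.choose_eq_zero_of_lt (by omega)] at h1
          simpa using h1
  -- so that `F` is the coefficient function of a polynomial cofactor `Q`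
  obtain ⟨Q, hQ⟩ : ∃ Q : Polynomial ℝ, (Q : PowerSeries ℝ) = PowerSeries.mk F := by
    refine ⟨PowerSeries.trunc (n - e + 1) (PowerSeries.mk F), ?_⟩
    ext k
    rw [Polynomial.coeff_coe, PowerSeries.coeff_trunc, PowerSeries.coeff_mk]
    split_ifs with hk
    · rfl
    · exact (hzero k (by omega)).symm
  have hdvd : (Polynomial.X ^ e + Polynomial.C 1 : Polynomial ℝ) ∣
      (Polynomial.X + Polynomial.C 1) ^ n := by
    refine ⟨Q, ?_⟩
    apply Polynomial.coe_injective
    ext k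
    simp only [Polynomial.coe_mul, Polynomial.coe_add, Polynomial.coe_pow, Polynomial.coe_X,
      Polynomial.coe_one, map_one, hQ]
    rw [add_comm (PowerSeries.X ^ e), coeff_one_add_X_pow_mul, add_comm PowerSeries.X,
      coeff_one_add_X_pow, PowerSeries.coeff_mk, PowerSeries.coeff_mk]
    split_ifs with h
    · have := hF (k - e)
      rw [show k - e + e = k by omega] at this
      exact this.symm
    · rw [hF0 k (by omega), add_zero]
  have hprime : Prime (Polynomial.X + Polynomial.C 1 : Polynomial ℝ) :=
    (Polynomial.monic_X_add_C 1).prime_of_degree_eq_one (Polynomial.degree_X_add_C 1)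
  obtain ⟨i, -, hi⟩ := (dvd_prime_pow hprime n).1 hdvd
  have heq := Polynomial.eq_of_monic_of_associated
    (Polynomial.monic_X_pow_add_C 1 (by omega : e ≠ 0)) ((Polynomial.monic_X_add_C 1).pow i) hi
  have hie : e = i := by
    have := congrArg Polynomial.natDegree heq
    rwa [Polynomial.natDegree_X_pow_add_C, Polynomial.natDegree_pow, Polynomial.natDegree_X_add_C,
      mul_one] at this
  -- `1 + z ^ e = (1 + z) ^ e`, evaluated at `z = 1`
  have h2 := congrArg (Polynomial.eval 1) heq
  simp only [Polynomial.eval_add, Polynomial.eval_pow, Polynomial.eval_X, Polynomial.eval_C,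
    one_pow] at h2
  have h4 : (1 + 1 : ℝ) ^ 2 ≤ (1 + 1) ^ i := pow_le_pow_right₀ (by norm_num) (by omega)
  rw [← h2] at h4
  norm_num at h4

/-- Once the index exceeds `n / 2` by a constant, a member of degree at least `2` is impossible. -/
lemma not_isDSemiRegular (hd : ∀ i, 0 < d i) (hlam : ∀ i, lam i ∈ grade n (d i)) {D : ℕ}
    (h : IsDSemiRegular D lam) {j : Fin m} (hj : 2 ≤ d j) (hn : 4 * d j ≤ n)
    (hD : n + 4 * d j ≤ 2 * D) : False := by
  set e := d j with he
  set F : PowerSeries ℝ := (1 + PowerSeries.X ^ e)⁻¹ * (1 + PowerSeries.X) ^ n with hFdef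
  have hF : ∀ k, PowerSeries.coeff k ((1 + PowerSeries.X ^ e) * F) = (n.choose k : ℝ) := by
    intro k
    rw [hFdef, ← mul_assoc, PowerSeries.mul_inv_cancel, one_mul, coeff_one_add_X_pow]
    simp [(show e ≠ 0 by omega)]
  -- below `D`, the coefficients of `F` are those of the Hilbert series of `B⁽ⁿ⁾ / (lam j)`
  have hH : ∀ k < D, PowerSeries.coeff k (hilb (Ideal.span {lam j})) = PowerSeries.coeff k F := by
    intro k
    induction k using Nat.strong_induction_on with
    | _ k ih =>
      intro hk
      have h1 := coeff_hilb_singleton hd hlam h j hk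
      have h2 := hF k
      rw [coeff_one_add_X_pow_mul] at h1 h2
      split_ifs at h1 h2 with hke
      · rw [ih (k - e) (by omega) (by omega)] at h1
        linarith
      · linarith
  refine not_symmetric_window (n := n) hj (by omega) (fun k => PowerSeries.coeff k F)
    (k₀ := (n - e) / 2 - e) (fun k hk => ?_) (fun k => ?_) (by omega) fun k h1 h2 => ?_
  · have := hF k
    rwa [coeff_one_add_X_pow_mul, if_neg (by omega), add_zero] at this
  · have := hF (k + e)
    rwa [coeff_one_add_X_pow_mul, if_pos (by omega), Nat.add_sub_cancel] at this
  · rw [← hH k (by omega), ← hH _ (by omega)]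
    exact coeff_hilb_singleton_symm hd hlam h j (by omega) (by omega) (by omega)

end Algebra

/-! ### Bounds for multiplication by a power series -/

/-- `OpBound u L`: multiplication by `u` enlarges uniform bounds on initial coefficients at most by
the factor `L`. This says that the absolute values of the coefficients of `u` sum to at most `L`,
in a form that is visibly submultiplicative. -/
def OpBound (u : PowerSeries ℝ) (L : ℝ) : Prop :=
  ∀ (F : PowerSeries ℝ) (M : ℝ) (t : ℕ), (∀ s ≤ t, |PowerSeries.coeff s F| ≤ M) →
    ∀ s ≤ t, |PowerSeries.coeff s (u * F)| ≤ L * M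

lemma opBound_of_sum_le {u : PowerSeries ℝ} {L : ℝ}
    (h : ∀ N, ∑ s ∈ Finset.range N, |PowerSeries.coeff s u| ≤ L) : OpBound u L := by
  intro F M t hF s hs
  have hM : 0 ≤ M := (abs_nonneg _).trans (hF s hs)
  rw [PowerSeries.coeff_mul, Finset.Nat.sum_antidiagonal_eq_sum_range_succ_mk]
  calc |∑ k ∈ Finset.range s.succ, PowerSeries.coeff k u * PowerSeries.coeff (s - k) F|
      ≤ ∑ k ∈ Finset.range s.succ, |PowerSeries.coeff k u| * M := by
        refine (Finset.abs_sum_le_sum_abs _ _).trans (Finset.sum_le_sum fun k _ => ?_)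
        rw [abs_mul]
        exact mul_le_mul_of_nonneg_left (hF _ (by omega)) (abs_nonneg _)
    _ ≤ L * M := by
        rw [← Finset.sum_mul]
        exact mul_le_mul_of_nonneg_right (h _) hM

lemma OpBound.mul {u v : PowerSeries ℝ} {L L' : ℝ} (hu : OpBound u L) (hv : OpBound v L') :
    OpBound (u * v) (L * L') := by
  intro F M t hF
  rw [mul_assoc, mul_assoc]
  exact hu _ _ t (hv F M t hF)

lemma OpBound.add {u v : PowerSeries ℝ} {L L' : ℝ} (hu : OpBound u L) (hv : OpBound v L') :
    OpBound (u + v) (L + L') := by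
  intro F M t hF s hs
  rw [add_mul, add_mul, map_add]
  exact (abs_add_le _ _).trans (add_le_add (hu F M t hF s hs) (hv F M t hF s hs))

lemma OpBound.mono {u : PowerSeries ℝ} {L L' : ℝ} (hu : OpBound u L) (h : L ≤ L') :
    OpBound u L' := by
  intro F M t hF s hs
  have hM : 0 ≤ M := (abs_nonneg _).trans (hF s hs)
  exact (hu F M t hF s hs).trans (mul_le_mul_of_nonneg_right h hM)

lemma opBound_zero : OpBound 0 0 := by
  intro F M t _ s _
  simp

lemma opBound_one : OpBound 1 1 := by
  intro F M t hF
  rwa [one_mul, one_mul]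

lemma opBound_C (c : ℝ) : OpBound (PowerSeries.C c) |c| := by
  intro F M t hF s hs
  rw [PowerSeries.coeff_C_mul, abs_mul]
  exact mul_le_mul_of_nonneg_left (hF s hs) (abs_nonneg _)

lemma opBound_X_pow (d : ℕ) : OpBound (PowerSeries.X ^ d) 1 := by
  intro F M t hF s hs
  have hM : 0 ≤ M := (abs_nonneg _).trans (hF s hs)
  rw [PowerSeries.coeff_X_pow_mul', one_mul]
  split_ifs
  · exact hF _ (by omega)
  · rwa [abs_zero]

lemma OpBound.pow {u : PowerSeries ℝ} {L : ℝ} (hu : OpBound u L) (k : ℕ) :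
    OpBound (u ^ k) (L ^ k) := by
  induction k with
  | zero => simpa using opBound_one
  | succ k ih => rw [pow_succ, pow_succ]; exact ih.mul hu

lemma opBound_geom_sum (d : ℕ) : OpBound (∑ i ∈ Finset.range d, PowerSeries.X ^ i) d := by
  induction d with
  | zero => simpa using opBound_zero
  | succ d ih =>
    rw [Finset.sum_range_succ, Nat.cast_succ]
    exact ih.add (opBound_X_pow d)

/-! ### Binomial distributions -/

/-- `q + p z`, the generating function of a Bernoulli variable. -/
noncomputable def bern (p q : ℝ) : PowerSeries ℝ :=
  PowerSeries.C q + PowerSeries.C p * PowerSeries.X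

lemma coeff_bern_pow (p q : ℝ) (N s : ℕ) : PowerSeries.coeff s (bern p q ^ N) =
    (N.choose s : ℝ) * p ^ s * q ^ (N - s) := by
  have h : bern p q ^ N =
      ((Polynomial.C q + Polynomial.C p * Polynomial.X) ^ N : Polynomial ℝ) := by
    simp [bern]
  rw [h, Polynomial.coeff_coe, add_comm, Commute.add_pow (Commute.all _ _),
    Polynomial.finsetSum_coeff]
  have : ∀ k, ((Polynomial.C p * Polynomial.X) ^ k * Polynomial.C q ^ (N - k) *
      (N.choose k : Polynomial ℝ)).coeff s = if s = k then
        (N.choose s : ℝ) * p ^ s * q ^ (N - s) else 0 := by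
    intro k
    have : (Polynomial.C p * Polynomial.X) ^ k * Polynomial.C q ^ (N - k) *
        (N.choose k : Polynomial ℝ) =
          Polynomial.C ((N.choose k : ℝ) * p ^ k * q ^ (N - k)) * Polynomial.X ^ k := by
      simp only [map_mul, map_pow, Polynomial.C_eq_natCast]
      ring
    rw [this, Polynomial.coeff_C_mul_X_pow]
    split_ifs with h
    · rw [h]
    · rfl
  simp only [this, Finset.sum_ite_eq, Finset.mem_range]
  split_ifs with hs
  · rfl
  · rw [Nat.choose_eq_zero_of_lt (by omega)]; simp

section Binomial

variable {p q : ℝ}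

lemma coeff_bern_pow_nonneg (hp : 0 ≤ p) (hq : 0 ≤ q) (N s : ℕ) :
    0 ≤ PowerSeries.coeff s (bern p q ^ N) := by
  rw [coeff_bern_pow]; positivity

lemma coeff_bern_pow_eq_bernstein (hpq : p + q = 1) (N s : ℕ) :
    PowerSeries.coeff s (bern p q ^ N) = (bernsteinPolynomial ℝ N s).eval p := by
  rw [coeff_bern_pow, bernsteinPolynomial]
  simp [show q = 1 - p by linarith]

lemma sum_coeff_bern_pow (hpq : p + q = 1) (N : ℕ) :
    ∑ s ∈ Finset.range (N + 1), PowerSeries.coeff s (bern p q ^ N) = 1 := by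
  have := congrArg (Polynomial.eval p) (bernsteinPolynomial.sum ℝ N)
  rw [Polynomial.eval_finsetSum] at this
  simpa only [coeff_bern_pow_eq_bernstein hpq, Polynomial.eval_one] using this

lemma sum_sq_mul_coeff_bern_pow (hpq : p + q = 1) (N : ℕ) :
    ∑ s ∈ Finset.range (N + 1), (N * p - s) ^ 2 * PowerSeries.coeff s (bern p q ^ N) =
      N * p * q := by
  have := congrArg (Polynomial.eval p) (bernsteinPolynomial.variance ℝ N)
  rw [Polynomial.eval_finsetSum] at this
  simp only [coeff_bern_pow_eq_bernstein hpq]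
  simpa [show q = 1 - p by linarith] using this

lemma opBound_bern (hp : 0 ≤ p) (hq : 0 ≤ q) (hpq : p + q = 1) : OpBound (bern p q) 1 := by
  have h := (opBound_C q).add ((opBound_C p).mul (opBound_X_pow 1))
  rw [abs_of_nonneg hp, abs_of_nonneg hq, pow_one] at h
  exact h.mono (by linarith)

/-- The coefficients of `(1 - z)(q + p z)ᴺ` are those of `(q + p z)ᴺ⁺¹`, multiplied by the deviation
from the mean. -/
lemma coeff_one_sub_X_mul_bern_pow (hpq : p + q = 1) (N s : ℕ) :
    (N + 1) * p * q * PowerSeries.coeff s ((1 - PowerSeries.X) * bern p q ^ N) =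
      ((N + 1 : ℕ) * p - s) * PowerSeries.coeff s (bern p q ^ (N + 1)) := by
  have hder : PowerSeries.derivative ℝ (bern p q ^ (N + 1)) =
      PowerSeries.C ((N + 1) * p) * bern p q ^ N := by
    rw [PowerSeries.derivative_pow, Nat.add_sub_cancel, map_mul, map_add, map_one, map_natCast]
    have : PowerSeries.derivative ℝ (bern p q) = PowerSeries.C p := by simp [bern]
    rw [this]
    push_cast
    ring
  have hX : PowerSeries.coeff s (PowerSeries.X * PowerSeries.derivative ℝ (bern p q ^ (N + 1))) =
      s * PowerSeries.coeff s (bern p q ^ (N + 1)) := by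
    cases s with
    | zero => simp
    | succ s =>
      rw [PowerSeries.coeff_succ_X_mul, PowerSeries.coeff_derivative]
      push_cast; ring
  have hid : PowerSeries.C ((N + 1) * p * q) * ((1 - PowerSeries.X) * bern p q ^ N) =
      PowerSeries.C ((N + 1) * p) * bern p q ^ (N + 1) -
        PowerSeries.X * PowerSeries.derivative ℝ (bern p q ^ (N + 1)) := by
    have h : PowerSeries.C q * (1 - PowerSeries.X) = bern p q - PowerSeries.X := by
      have hp : PowerSeries.C p = 1 - PowerSeries.C q := by
        rw [← map_one PowerSeries.C, ← map_sub]; congr 1; linarith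
      rw [bern, hp]; ring
    rw [hder, pow_succ, map_mul PowerSeries.C _ q]
    linear_combination (PowerSeries.C ((N + 1) * p) * bern p q ^ N) * h
  have := congrArg (PowerSeries.coeff s) hid
  rw [PowerSeries.coeff_C_mul, map_sub, PowerSeries.coeff_C_mul, hX] at this
  rw [this]
  push_cast; ring

/-- The total variation of a binomial distribution, bounded through its variance. -/
lemma opBound_one_sub_X_mul_bern_pow {κ : ℝ} (hκ : 0 < κ) (hp : 0 ≤ p) (hq : 0 ≤ q)
    (hpq : p + q = 1) (hκpq : κ ≤ p * q) (N : ℕ) :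
    OpBound ((1 - PowerSeries.X) * bern p q ^ N) (1 / √(κ * (N + 1))) := by
  have hpq0 : 0 < p * q := hκ.trans_le hκpq
  set σ := √((N + 1) * (p * q)) with hσ
  have hσ0 : 0 < σ := Real.sqrt_pos.2 (by positivity)
  have hσ2 : σ ^ 2 = (N + 1) * (p * q) := Real.sq_sqrt (by positivity)
  have hb := coeff_bern_pow_nonneg hp hq (N + 1)
  have hdev : ∑ s ∈ Finset.range (N + 1 + 1), |((N + 1 : ℕ) : ℝ) * p - s| *
      PowerSeries.coeff s (bern p q ^ (N + 1)) ≤ σ := by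
    have h1 := sum_coeff_bern_pow hpq (N + 1)
    have h2 := sum_sq_mul_coeff_bern_pow hpq (N + 1)
    -- `2 σ |y| ≤ y ^ 2 + σ ^ 2`, averaged over the distribution
    have h3 : 2 * σ * ∑ s ∈ Finset.range (N + 1 + 1), |((N + 1 : ℕ) : ℝ) * p - s| *
        PowerSeries.coeff s (bern p q ^ (N + 1)) ≤ σ ^ 2 + σ ^ 2 := by
      have h4 : σ ^ 2 + σ ^ 2 = ∑ s ∈ Finset.range (N + 1 + 1),
          ((((N + 1 : ℕ) : ℝ) * p - s) ^ 2 + σ ^ 2) *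
            PowerSeries.coeff s (bern p q ^ (N + 1)) := by
        simp only [add_mul]
        rw [Finset.sum_add_distrib, ← Finset.mul_sum, h1, h2, hσ2]
        push_cast; ring
      rw [h4, Finset.mul_sum]
      refine Finset.sum_le_sum fun s _ => ?_
      rw [← mul_assoc]
      refine mul_le_mul_of_nonneg_right ?_ (hb s)
      have := sq_nonneg (|((N + 1 : ℕ) : ℝ) * p - s| - σ)
      rw [sub_sq, sq_abs] at this
      linarith
    nlinarith
  have hsum : ∀ M, ∑ s ∈ Finset.range M,
      |PowerSeries.coeff s ((1 - PowerSeries.X) * bern p q ^ N)| ≤ 1 / σ := by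
    intro M
    have hterm : ∀ s, |PowerSeries.coeff s ((1 - PowerSeries.X) * bern p q ^ N)| =
        (1 / σ ^ 2) * (|((N + 1 : ℕ) : ℝ) * p - s| *
          PowerSeries.coeff s (bern p q ^ (N + 1))) := by
      intro s
      have h1 := coeff_one_sub_X_mul_bern_pow hpq N s
      rw [mul_assoc (_ + 1 : ℝ) p q, ← hσ2] at h1
      have h2 := congrArg abs h1
      rw [abs_mul, abs_mul, abs_of_nonneg (hb s), abs_of_nonneg (sq_nonneg σ)] at h2
      rw [← h2]
      field_simp
    have hM : ∑ s ∈ Finset.range M, |((N + 1 : ℕ) : ℝ) * p - s| *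
          PowerSeries.coeff s (bern p q ^ (N + 1)) ≤ σ := by
      refine le_trans ?_ hdev
      rw [← Finset.sum_filter_add_sum_filter_not (Finset.range M) (fun s => s < N + 1 + 1)]
      have hz : ∑ s ∈ (Finset.range M).filter (fun s => ¬ s < N + 1 + 1),
          |((N + 1 : ℕ) : ℝ) * p - s| * PowerSeries.coeff s (bern p q ^ (N + 1)) = 0 := by
        refine Finset.sum_eq_zero fun s hs => ?_
        rw [Finset.mem_filter] at hs
        rw [coeff_bern_pow, Nat.choose_eq_zero_of_lt (by omega)]
        simp
      rw [hz, add_zero]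
      refine Finset.sum_le_sum_of_subset_of_nonneg (fun s hs => ?_) fun s _ _ =>
        mul_nonneg (abs_nonneg _) (hb s)
      rw [Finset.mem_filter] at hs
      exact Finset.mem_range.2 hs.2
    simp only [hterm]
    rw [← Finset.mul_sum]
    calc 1 / σ ^ 2 * _ ≤ 1 / σ ^ 2 * σ := mul_le_mul_of_nonneg_left hM (by positivity)
      _ = 1 / σ := by field_simp
  refine (opBound_of_sum_le hsum).mono ?_
  refine one_div_le_one_div_of_le (Real.sqrt_pos.2 (by positivity)) (Real.sqrt_le_sqrt ?_)
  rw [mul_comm]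
  exact mul_le_mul_of_nonneg_left hκpq (by positivity)

lemma abs_coeff_bern_pow_le {κ : ℝ} (hκ : 0 < κ) (hp : 0 ≤ p) (hq : 0 ≤ q)
    (hpq : p + q = 1) (hκpq : κ ≤ p * q) (N s : ℕ) :
    |PowerSeries.coeff s (bern p q ^ N)| ≤ 1 / √(κ * (N + 1)) := by
  have h := opBound_one_sub_X_mul_bern_pow hκ hp hq hpq hκpq N (PowerSeries.mk 1) 1 s
    (fun s _ => by simp) s le_rfl
  rwa [mul_right_comm, mul_comm (1 - PowerSeries.X), PowerSeries.mk_one_mul_one_sub_eq_one, one_mul,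
    mul_one] at h

/-- The mode of a binomial distribution of integral mean is its mean. -/
lemma coeff_bern_pow_le_mode {n t : ℕ} (ht0 : 0 < t) (htn : t < n) (hp : p = t / n)
    (hq : q = (n - t) / n) (s : ℕ) :
    PowerSeries.coeff s (bern p q ^ n) ≤ PowerSeries.coeff t (bern p q ^ n) := by
  have hn : (0 : ℝ) < n := by exact_mod_cast (by omega : 0 < n)
  have htn' : (0 : ℝ) < n - t := sub_pos.2 (by exact_mod_cast htn)
  have ht0' : (0 : ℝ) < t := by exact_mod_cast ht0
  set b := fun s => PowerSeries.coeff s (bern p q ^ n) with hb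
  have hb0 : ∀ s, 0 ≤ b s :=
    coeff_bern_pow_nonneg (by rw [hp]; positivity) (by rw [hq]; positivity) n
  have hratio : ∀ s < n, b (s + 1) * ((s + 1) * (n - t)) = b s * ((n - s) * t) := by
    intro s hs
    have h1 : (n.choose (s + 1) : ℝ) * (s + 1) = n.choose s * (n - s) := by
      have := Nat.choose_succ_right_eq n s
      rw [← Nat.cast_sub hs.le]
      exact_mod_cast this
    have hq' : (n - t : ℝ) = n * q := by rw [hq]; field_simp
    have hp' : (t : ℝ) = n * p := by rw [hp]; field_simp
    simp only [hb, coeff_bern_pow]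
    rw [hq', hp', show n - s = n - (s + 1) + 1 by omega]
    linear_combination (p ^ (s + 1) * q ^ (n - (s + 1)) * q * n) * h1
  have hup : ∀ s < t, b s ≤ b (s + 1) := by
    intro s hs
    have h1 := hratio s (by omega)
    have h2 : (s : ℝ) + 1 ≤ t := by exact_mod_cast hs
    have h3 : ((s : ℝ) + 1) * (n - t) ≤ (n - s) * t := by nlinarith
    have h4 := mul_le_mul_of_nonneg_left h3 (hb0 s)
    rw [← h1] at h4
    exact le_of_mul_le_mul_right h4 (by positivity)
  have hdown : ∀ s, t ≤ s → b (s + 1) ≤ b s := by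
    intro s hs
    by_cases hsn : s < n
    · have h1 := hratio s hsn
      have h2 : (t : ℝ) ≤ s := by exact_mod_cast hs
      have h3 : (n - s) * t ≤ ((s : ℝ) + 1) * (n - t) := by nlinarith
      have h4 := mul_le_mul_of_nonneg_left h3 (hb0 s)
      rw [← h1] at h4
      exact le_of_mul_le_mul_right h4 (by positivity)
    · have : b (s + 1) = 0 := by
        simp only [hb, coeff_bern_pow]
        rw [Nat.choose_eq_zero_of_lt (by omega)]; simp
      rw [this]
      exact hb0 s
  rcases le_total s t with hst | hst
  · have : ∀ j ≤ t, b (t - j) ≤ b t := by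
      intro j
      induction j with
      | zero => intro _; simp
      | succ j ih =>
        intro hj
        refine le_trans ?_ (ih (by omega))
        have := hup (t - (j + 1)) (by omega)
        rwa [show t - (j + 1) + 1 = t - j by omega] at this
    have h := this (t - s) (by omega)
    rwa [show t - (t - s) = s by omega] at h
  · induction s, hst using Nat.le_induction with
    | base => exact le_rfl
    | succ s hs ih => exact (hdown s hs).trans ih

/-- Chebyshev's inequality gives a lower bound for the largest binomial probability. -/
lemma le_coeff_bern_pow_mode {n t : ℕ} (ht0 : 0 < t) (htn : t < n) (hp : p = t / n)
    (hq : q = (n - t) / n) : 1 / (4 * √n) ≤ PowerSeries.coeff t (bern p q ^ n) := by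
  have hn : (0 : ℝ) < n := by exact_mod_cast (by omega : 0 < n)
  have hn1 : (1 : ℝ) ≤ n := by exact_mod_cast (by omega : 1 ≤ n)
  have htn' : (0 : ℝ) < n - t := sub_pos.2 (by exact_mod_cast htn)
  have hpq : p + q = 1 := by rw [hp, hq]; field_simp; ring
  set b := fun s => PowerSeries.coeff s (bern p q ^ n) with hb
  have hb0 : ∀ s, 0 ≤ b s :=
    coeff_bern_pow_nonneg (by rw [hp]; positivity) (by rw [hq]; positivity) n
  set c := Nat.sqrt n + 1 with hc
  have hcn : (n : ℝ) ≤ (c : ℝ) ^ 2 := by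
    have : n < c * c := Nat.lt_succ_sqrt n
    rw [pow_two]
    exact_mod_cast this.le
  have hsum := sum_coeff_bern_pow hpq n
  have hvar := sum_sq_mul_coeff_bern_pow hpq n
  have hnp : (n : ℝ) * p = t := by rw [hp]; field_simp
  rw [← Finset.sum_filter_add_sum_filter_not _ (fun s => s < t + c ∧ t < s + c)] at hsum
  have hfar : n * ∑ s ∈ (Finset.range (n + 1)).filter (fun s => ¬ (s < t + c ∧ t < s + c)), b s ≤
      n * p * q := by
    rw [← hvar, Finset.mul_sum]
    refine le_trans (Finset.sum_le_sum (g := fun s => (n * p - s) ^ 2 * b s) fun s hs => ?_)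
      (Finset.sum_le_sum_of_subset_of_nonneg (Finset.filter_subset _ _) fun s _ _ =>
        mul_nonneg (sq_nonneg _) (hb0 s))
    refine mul_le_mul_of_nonneg_right (hcn.trans ?_) (hb0 s)
    rw [hnp]
    have hs := (Finset.mem_filter.1 hs).2
    rw [not_and_or, not_lt, not_lt] at hs
    rcases hs with hs | hs
    · have : (t : ℝ) + c ≤ s := by exact_mod_cast hs
      nlinarith [(Nat.cast_nonneg c : (0 : ℝ) ≤ c)]
    · have : (s : ℝ) + c ≤ t := by exact_mod_cast hs
      nlinarith [(Nat.cast_nonneg c : (0 : ℝ) ≤ c)]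
  have hfar' : ∑ s ∈ (Finset.range (n + 1)).filter (fun s => ¬ (s < t + c ∧ t < s + c)), b s ≤
      1 / 4 := by
    rw [mul_assoc] at hfar
    have := le_of_mul_le_mul_left hfar hn
    nlinarith [sq_nonneg (p - q)]
  have hcard : (((Finset.range (n + 1)).filter (fun s => s < t + c ∧ t < s + c)).card : ℝ) ≤
      3 * √n := by
    have h1 : ((Finset.range (n + 1)).filter (fun s => s < t + c ∧ t < s + c)).card ≤
        2 * Nat.sqrt n + 1 := by
      refine (Finset.card_le_card (t := Finset.Ico (t + 1 - c) (t + c)) fun s hs => ?_).trans ?_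
      · have := (Finset.mem_filter.1 hs).2
        rw [Finset.mem_Ico]; omega
      · rw [Nat.card_Ico]; omega
    have h2 : (Nat.sqrt n : ℝ) ≤ √n := Real.nat_sqrt_le_real_sqrt
    have h3 : 1 ≤ √(n : ℝ) := Real.one_le_sqrt.2 hn1
    have h4 : (((Finset.range (n + 1)).filter (fun s => s < t + c ∧ t < s + c)).card : ℝ) ≤
        2 * Nat.sqrt n + 1 := by exact_mod_cast h1
    linarith
  have hnear : ∑ s ∈ (Finset.range (n + 1)).filter (fun s => s < t + c ∧ t < s + c), b s ≤
      3 * √n * b t := by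
    refine (Finset.sum_le_card_nsmul _ _ (b t) fun s _ =>
      coeff_bern_pow_le_mode ht0 htn hp hq s).trans ?_
    rw [nsmul_eq_mul]
    exact mul_le_mul_of_nonneg_right hcard (hb0 t)
  have hs0 : 0 < √(n : ℝ) := Real.sqrt_pos.2 hn
  rw [div_le_iff₀ (by positivity)]
  change 1 ≤ b t * (4 * √n)
  linarith

/-! ### Dividing a binomial distribution by a perturbation of `1` -/

/-- If `R` is a small perturbation of `1` near `z = 1`, then dividing by `R` changes a high power of
`q + p z` only slightly: the Neumann series for `1 / R` is controlled by the smoothing effect of the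
powers of `q + p z` on `1 - z`. -/
lemma abs_coeff_bern_pow_mul_sub_le {κ δ M : ℝ} (hκ : 0 < κ) (hp : 0 ≤ p) (hq : 0 ≤ q)
    (hpq : p + q = 1) (hκpq : κ ≤ p * q) (hδ : 0 ≤ δ) {R E w : PowerSeries ℝ} (hRE : R * E = 1)
    (hw : 1 - R = (1 - PowerSeries.X) * w) (hwδ : OpBound w δ) {K : ℕ}
    (hK : δ * (1 / √(κ * (K + 1))) ≤ 1 / 2) {n r t : ℕ} (hn : 0 < n) (hr0 : 0 < r)
    (hr : 2 * (r * K) ≤ n)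
    (hE : ∀ s ≤ t, |PowerSeries.coeff s E| ≤ M) :
    |PowerSeries.coeff t (bern p q ^ n * E) - PowerSeries.coeff t (bern p q ^ n)| ≤
      8 * δ / (κ * n) + (1 / 2) ^ r * M := by
  have hM : 0 ≤ M := (abs_nonneg _).trans (hE t le_rfl)
  set a := bern p q with ha
  set u := 1 - R with hu
  have ha1 : ∀ N, OpBound (a ^ N) 1 := fun N => by
    simpa using (opBound_bern hp hq hpq).pow N
  have hv : OpBound (u * a ^ K) (1 / 2) := by
    have := (hwδ.mul (opBound_one_sub_X_mul_bern_pow hκ hp hq hpq hκpq K)).mono hK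
    rwa [← mul_assoc, mul_comm w, ← hw] at this
  have hexp : ∀ r, E = ∑ j ∈ Finset.range r, u ^ j + u ^ r * E := by
    intro r
    have h1 := mul_neg_geom_sum u r
    rw [hu, sub_sub_cancel, ← hu] at h1
    calc E = (1 - u ^ r) * E + u ^ r * E := by ring
      _ = (R * E) * (∑ j ∈ Finset.range r, u ^ j) + u ^ r * E := by rw [← h1]; ring
      _ = _ := by rw [hRE, one_mul]
  -- the last term of the expansion
  have htail : ∀ r, 2 * (r * K) ≤ n →
      |PowerSeries.coeff t (u ^ r * (a ^ n * E))| ≤ (1 / 2) ^ r * M := by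
    intro r hr
    have h1 := ((hv.pow r).mul (ha1 (n - r * K))) E M t hE t le_rfl
    have h2 : u ^ r * (a ^ n * E) = (u * a ^ K) ^ r * a ^ (n - r * K) * E := by
      rw [mul_pow, ← pow_mul, mul_comm K r, mul_assoc (u ^ r), ← pow_add,
        Nat.add_sub_cancel' (by omega), mul_assoc]
    rw [h2]
    simpa using h1
  -- the intermediate terms: `j` factors `u * a ^ K` give the geometric decay; of the rest, one
  -- factor `a ^ N` is spent on the difference `1 - z`, another one on the bound for probabilities
  set N := n / 4 with hN
  have hNn : 4 * ((N : ℝ) + 1) ≥ n := by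
    have : n ≤ 4 * (N + 1) := by omega
    exact_mod_cast this
  have hmid : ∀ j, 2 * (j * K) ≤ n →
      |PowerSeries.coeff t (u ^ (j + 1) * a ^ n)| ≤ (1 / 2) ^ j * (4 * δ / (κ * n)) := by
    intro j hj
    have h1 := (((hv.pow j).mul (ha1 (n - j * K - 2 * N))).mul
      (hwδ.mul (opBound_one_sub_X_mul_bern_pow hκ hp hq hpq hκpq N))) (a ^ N) _ t
      (fun s _ => abs_coeff_bern_pow_le hκ hp hq hpq hκpq N s) t le_rfl
    have h2 : u ^ (j + 1) * a ^ n = (u * a ^ K) ^ j * a ^ (n - j * K - 2 * N) *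
        (w * ((1 - PowerSeries.X) * a ^ N)) * a ^ N := by
      have h3 : a ^ n = (a ^ K) ^ j * a ^ (n - j * K - 2 * N) * a ^ N * a ^ N := by
        rw [← pow_mul, ← pow_add, ← pow_add, ← pow_add]
        congr 1
        rw [mul_comm K j]
        omega
      rw [h3, pow_succ, mul_pow]
      linear_combination (u ^ j * (a ^ K) ^ j * a ^ (n - j * K - 2 * N) * a ^ N * a ^ N) * hw
    rw [h2]
    refine h1.trans ?_
    have hs : 1 / √(κ * (N + 1)) * (1 / √(κ * (N + 1))) = 1 / (κ * (N + 1)) := by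
      rw [div_mul_div_comm, one_mul, Real.mul_self_sqrt (by positivity)]
    have hn' : (0 : ℝ) < n := by exact_mod_cast hn
    have h4 : 1 / (κ * (N + 1)) ≤ 4 / (κ * n) := by
      rw [div_le_div_iff₀ (by positivity) (by positivity)]
      nlinarith
    calc (1 / 2 : ℝ) ^ j * 1 * (δ * (1 / √(κ * (N + 1)))) * (1 / √(κ * (N + 1)))
        = (1 / 2) ^ j * (δ * (1 / √(κ * (N + 1)) * (1 / √(κ * (N + 1))))) := by ring
      _ ≤ (1 / 2) ^ j * (δ * (4 / (κ * n))) := by rw [hs]; gcongr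
      _ = _ := by ring
  have hn' : (0 : ℝ) < n := by exact_mod_cast hn
  have hc : 0 ≤ 4 * δ / (κ * n) := by positivity
  obtain ⟨r, rfl⟩ : ∃ r', r = r' + 1 := ⟨r - 1, by omega⟩
  have h1 : PowerSeries.coeff t (a ^ n * E) - PowerSeries.coeff t (a ^ n) =
      ∑ j ∈ Finset.range r, PowerSeries.coeff t (u ^ (j + 1) * a ^ n) +
        PowerSeries.coeff t (u ^ (r + 1) * (a ^ n * E)) := by
    have h2 : a ^ n * E = ∑ j ∈ Finset.range r, u ^ (j + 1) * a ^ n + a ^ n +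
        u ^ (r + 1) * (a ^ n * E) := by
      conv_lhs => rw [hexp (r + 1), Finset.sum_range_succ']
      rw [← Finset.sum_mul]
      ring
    have h3 := congrArg (PowerSeries.coeff t) h2
    rw [map_add, map_add, map_sum] at h3
    linarith
  rw [h1]
  refine (abs_add_le _ _).trans (add_le_add ?_ (htail _ hr))
  calc |∑ j ∈ Finset.range r, PowerSeries.coeff t (u ^ (j + 1) * a ^ n)|
      ≤ ∑ j ∈ Finset.range r, (1 / 2 : ℝ) ^ j * (4 * δ / (κ * n)) := by
        refine (Finset.abs_sum_le_sum_abs _ _).trans (Finset.sum_le_sum fun j hj => hmid j ?_)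
        have := Finset.mem_range.1 hj
        have : j * K ≤ (r + 1) * K := Nat.mul_le_mul_right _ (by omega)
        omega
    _ ≤ 2 * (4 * δ / (κ * n)) := by
        rw [← Finset.sum_mul]
        refine mul_le_mul_of_nonneg_right ?_ hc
        exact sum_geometric_two_le r
    _ = 8 * δ / (κ * n) := by ring

end Binomial

/-! ### Positivity of the coefficients of `(1 + z)ⁿ / ∏ᵢ (1 + z^{dᵢ})` -/

lemma abs_coeff_inv_denom_le {ι : Type*} {d : ι → ℕ} (hd : ∀ i, 0 < d i) (T : Finset ι) (s : ℕ) :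
    |PowerSeries.coeff s (denom d T)⁻¹| ≤ ((s : ℝ) + 1) ^ T.card := by
  classical
  induction T using Finset.induction_on generalizing s with
  | empty =>
    rw [show denom d ∅ = 1 from Finset.prod_empty, show (1 : PowerSeries ℝ)⁻¹ = 1 by simp,
      PowerSeries.coeff_one]
    split_ifs <;> simp
  | insert i T hi ih =>
    set F := (denom d T)⁻¹ with hF
    set Y := (denom d (insert i T))⁻¹ with hY
    have hYF : (1 + PowerSeries.X ^ d i) * Y = F := by
      rw [hY, denom_insert d hi, PowerSeries.mul_inv_rev, ← hF, mul_left_comm,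
        PowerSeries.mul_inv_cancel, mul_one]
      simp [(hd i).ne']
    rw [Finset.card_insert_of_notMem hi]
    induction s using Nat.strong_induction_on with
    | _ s ihs =>
      have h1 := congrArg (PowerSeries.coeff s) hYF
      rw [coeff_one_add_X_pow_mul] at h1
      have h2 := ih s
      have hpow : ((s : ℝ) + 1) ^ (T.card + 1) = s * (s + 1) ^ T.card + (s + 1) ^ T.card := by ring
      have h0 : (0 : ℝ) ≤ s * (s + 1) ^ T.card := by positivity
      split_ifs at h1 with hds
      · have hdi := hd i
        have h3 := ihs (s - d i) (by omega)
        have h4 : ((s - d i : ℕ) : ℝ) + 1 ≤ s := by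
          have : s - d i + 1 ≤ s := by omega
          exact_mod_cast this
        have h5 : (((s - d i : ℕ) : ℝ) + 1) ^ (T.card + 1) ≤ s * (s + 1) ^ T.card := by
          rw [pow_succ, mul_comm]
          refine mul_le_mul h4 (pow_le_pow_left₀ (by positivity) (h4.trans (by linarith)) _)
            (by positivity) (by positivity)
        rw [eq_sub_of_add_eq h1, hpow]
        exact (abs_sub _ _).trans (by linarith)
      · rw [add_zero] at h1
        rw [h1, hpow]
        linarith

variable {m : ℕ} {d : Fin m → ℕ}

/-- In low degrees the binomial coefficients grow faster than the coefficients of the inverse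
denominator, so that the leading term dominates. -/
lemma coeff_hilbertQuotient_pos_of_small (hd : ∀ i, 0 < d i) {n t : ℕ}
    (h : (2 ^ (m + 2) + 1) * t ≤ n + 1) : 0 < PowerSeries.coeff t (hilbertQuotient d n) := by
  set A := 2 ^ (m + 2) with hA
  have hA0 : 0 < A := by positivity
  have htn : t ≤ n := by
    have : 2 * t ≤ (A + 1) * t := Nat.mul_le_mul_right _ (by omega)
    omega
  have hchoose : ∀ s ≤ t, A ^ s * n.choose (t - s) ≤ n.choose t := by
    intro s
    induction s with
    | zero => intro _; simp
    | succ s ih =>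
      intro hs
      refine le_trans ?_ (ih (by omega))
      rw [pow_succ, mul_assoc]
      refine Nat.mul_le_mul_left _ ?_
      obtain ⟨k, hk⟩ : ∃ k, t - s = k + 1 := ⟨t - s - 1, by omega⟩
      rw [show t - (s + 1) = k by omega, hk]
      have h1 := Nat.choose_succ_right_eq n k
      have h2 : A * (k + 1) ≤ n - k := by
        have : (A + 1) * (k + 1) ≤ (A + 1) * t := Nat.mul_le_mul_left _ (by omega)
        have : (A + 1) * (k + 1) = A * (k + 1) + (k + 1) := by ring
        omega
      refine Nat.le_of_mul_le_mul_right (c := k + 1) ?_ (by omega)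
      rw [h1, mul_comm A, mul_assoc]
      exact Nat.mul_le_mul_left _ h2
  set c : ℝ := (n.choose t : ℝ) with hc
  have hc0 : 0 < c := by
    rw [hc]
    exact_mod_cast Nat.choose_pos htn
  have hterm : ∀ s, s + 1 ≤ t → |PowerSeries.coeff (s + 1) (denom d Finset.univ)⁻¹ *
      (n.choose (t - (s + 1)) : ℝ)| ≤ c * (1 / 4) * (1 / 4) ^ s := by
    intro s hs
    have h1 := abs_coeff_inv_denom_le hd Finset.univ (s + 1)
    rw [Finset.card_univ, Fintype.card_fin] at h1
    have h2 : (((s + 1 : ℕ) : ℝ) + 1) ^ m ≤ (2 ^ m) ^ (s + 1) := by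
      rw [← pow_mul, mul_comm m, pow_mul]
      refine pow_le_pow_left₀ (by positivity) ?_ _
      have : s + 1 < 2 ^ (s + 1) := Nat.lt_two_pow_self
      exact_mod_cast this
    have h3 : ((2 : ℝ) ^ m) ^ (s + 1) * 4 ^ (s + 1) * n.choose (t - (s + 1)) ≤ c := by
      have h4 := hchoose (s + 1) hs
      rw [hA, pow_add 2 m 2, mul_pow] at h4
      rw [hc]
      exact_mod_cast h4
    rw [abs_mul, Nat.abs_cast]
    calc _ ≤ ((2 : ℝ) ^ m) ^ (s + 1) * (n.choose (t - (s + 1)) : ℝ) :=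
          mul_le_mul_of_nonneg_right (h1.trans h2) (Nat.cast_nonneg _)
      _ = (((2 : ℝ) ^ m) ^ (s + 1) * 4 ^ (s + 1) * n.choose (t - (s + 1))) * (1 / 4) ^ (s + 1) := by
          rw [one_div, inv_pow]; field_simp
      _ ≤ c * (1 / 4) ^ (s + 1) := mul_le_mul_of_nonneg_right h3 (by positivity)
      _ = _ := by ring
  have hcoeff : PowerSeries.coeff t (hilbertQuotient d n) =
      ∑ s ∈ Finset.range t, PowerSeries.coeff (s + 1) (denom d Finset.univ)⁻¹ *
        (n.choose (t - (s + 1)) : ℝ) + c := by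
    change PowerSeries.coeff t ((1 + PowerSeries.X) ^ n * (denom d Finset.univ)⁻¹) = _
    rw [mul_comm, PowerSeries.coeff_mul, Finset.Nat.sum_antidiagonal_eq_sum_range_succ_mk,
      Finset.sum_range_succ']
    simp only [coeff_one_add_X_pow]
    congr 1
    rw [PowerSeries.coeff_zero_eq_constantCoeff_apply, PowerSeries.constantCoeff_inv,
      constantCoeff_denom hd]
    simp [hc]
  have hsum : |∑ s ∈ Finset.range t, PowerSeries.coeff (s + 1) (denom d Finset.univ)⁻¹ *
        (n.choose (t - (s + 1)) : ℝ)| ≤ c * (1 / 4) * 2 := by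
    refine (Finset.abs_sum_le_sum_abs _ _).trans ((Finset.sum_le_sum fun s hs =>
      hterm s (Finset.mem_range.1 hs)).trans ?_)
    rw [← Finset.mul_sum]
    refine mul_le_mul_of_nonneg_left (le_trans ?_ (sum_geometric_two_le t)) (by positivity)
    exact Finset.sum_le_sum fun s _ => pow_le_pow_left₀ (by norm_num) (by norm_num) _
  rw [hcoeff]
  have := (abs_le.1 hsum).1
  linarith

/-- `∏ᵢ (1 + x^{dᵢ})`. -/
noncomputable def denomEval {ι : Type*} (d : ι → ℕ) (T : Finset ι) (x : ℝ) : ℝ :=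
  ∏ i ∈ T, (1 + x ^ d i)

lemma denomEval_pos {ι : Type*} (d : ι → ℕ) (T : Finset ι) {x : ℝ} (hx : 0 ≤ x) :
    0 < denomEval d T x := Finset.prod_pos fun i _ => by positivity

/-- The denominator, normalized and rescaled as `P(x z) / P(x)`, is `1` at `z = 1`; its deviation
from `1` is a multiple of `1 - z` by a factor which is bounded independently of `x`. -/
lemma exists_one_sub_rescale_denom {ι : Type*} (d : ι → ℕ) (T : Finset ι) {x : ℝ} (hx : 0 ≤ x) :
    OpBound (PowerSeries.C (denomEval d T x)⁻¹ * PowerSeries.rescale x (denom d T)) 1 ∧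
    ∃ w, 1 - PowerSeries.C (denomEval d T x)⁻¹ * PowerSeries.rescale x (denom d T) =
      (1 - PowerSeries.X) * w ∧ OpBound w (∑ i ∈ T, d i : ℕ) := by
  classical
  induction T using Finset.induction_on with
  | empty =>
    simp only [denomEval, denom, Finset.prod_empty, inv_one, map_one, mul_one, sub_self]
    exact ⟨opBound_one, 0, by simp, by simpa using opBound_zero⟩
  | insert i T hi ih =>
    obtain ⟨hR, w, hw, hwb⟩ := ih
    set R := PowerSeries.C (denomEval d T x)⁻¹ * PowerSeries.rescale x (denom d T) with hRdef
    set y := x ^ d i with hy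
    have hy0 : 0 ≤ y := pow_nonneg hx _
    set S : PowerSeries ℝ := PowerSeries.C (1 + y)⁻¹ + PowerSeries.C (y / (1 + y)) *
      PowerSeries.X ^ d i with hS
    have hprod : PowerSeries.C (denomEval d (insert i T) x)⁻¹ *
        PowerSeries.rescale x (denom d (insert i T)) = S * R := by
      have h1 : denomEval d (insert i T) x = (1 + y) * denomEval d T x := Finset.prod_insert hi
      have h2 : PowerSeries.rescale x (1 + PowerSeries.X ^ d i) =
          1 + PowerSeries.C y * PowerSeries.X ^ d i := by
        rw [map_add, map_one, map_pow, PowerSeries.rescale_X, mul_pow, ← map_pow]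
      rw [h1, mul_inv, denom_insert d hi, map_mul, map_mul, h2, hS, hRdef, div_eq_mul_inv, map_mul]
      ring
    have hone : PowerSeries.C (1 + y)⁻¹ + PowerSeries.C (y / (1 + y)) = 1 := by
      rw [← map_add, ← map_one PowerSeries.C]
      congr 1
      field_simp
    have hSb : OpBound S 1 := by
      have := (opBound_C (1 + y)⁻¹).add ((opBound_C (y / (1 + y))).mul (opBound_X_pow (d i)))
      refine this.mono (le_of_eq ?_)
      rw [abs_of_nonneg (by positivity), abs_of_nonneg (by positivity)]
      field_simp
    have hS1 : 1 - S = (1 - PowerSeries.X) *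
        (PowerSeries.C (y / (1 + y)) * ∑ k ∈ Finset.range (d i), PowerSeries.X ^ k) := by
      have := mul_neg_geom_sum (PowerSeries.X : PowerSeries ℝ) (d i)
      rw [mul_left_comm, this, hS]
      linear_combination -hone
    rw [hprod]
    refine ⟨by simpa using hSb.mul hR, PowerSeries.C (y / (1 + y)) *
      ∑ k ∈ Finset.range (d i), PowerSeries.X ^ k + S * w, ?_, ?_⟩
    · linear_combination hS1 + S * hw
    · rw [Finset.sum_insert hi, Nat.cast_add]
      refine OpBound.add ?_ ((hSb.mul hwb).mono (by simp))
      refine ((opBound_C _).mul (opBound_geom_sum (d i))).mono ?_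
      rw [abs_of_nonneg (by positivity)]
      refine mul_le_of_le_one_left (Nat.cast_nonneg _) ?_
      rw [div_le_one (by positivity)]
      linarith

/-- Exponential tilting: up to a positive factor, the coefficients of `(1 + z)ⁿ / P(z)` are those of
`(q + p z)ⁿ · P(p/q) / P(z p/q)`. -/
lemma coeff_bern_pow_mul_rescale (n t : ℕ) {p q : ℝ} (hq : 0 < q) :
    PowerSeries.coeff t (bern p q ^ n * (PowerSeries.C (denomEval d Finset.univ (p / q)) *
      PowerSeries.rescale (p / q) (denom d Finset.univ)⁻¹)) =
    q ^ n * denomEval d Finset.univ (p / q) * (p / q) ^ t *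
      PowerSeries.coeff t (hilbertQuotient d n) := by
  have h1 : bern p q = PowerSeries.C q * PowerSeries.rescale (p / q) (1 + PowerSeries.X) := by
    rw [map_add, map_one, PowerSeries.rescale_X, mul_add, mul_one, ← mul_assoc, ← map_mul,
      mul_div_cancel₀ _ hq.ne']
    rfl
  have h2 : bern p q ^ n * (PowerSeries.C (denomEval d Finset.univ (p / q)) *
      PowerSeries.rescale (p / q) (denom d Finset.univ)⁻¹) =
      PowerSeries.C (q ^ n * denomEval d Finset.univ (p / q)) *
        PowerSeries.rescale (p / q) (hilbertQuotient d n) := by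
    change _ = _ * PowerSeries.rescale (p / q) ((1 + PowerSeries.X) ^ n * (denom d Finset.univ)⁻¹)
    rw [h1, mul_pow, map_mul, map_mul, map_pow, map_pow]
    ring
  rw [h2, PowerSeries.coeff_C_mul, PowerSeries.coeff_rescale]
  ring

/-- The error bound in the comparison with binomial probabilities is eventually smaller than the
largest binomial probability. -/
lemma eventually_error_lt (a b : ℝ) (k : ℕ) {ρ : ℝ} (hρ : 1 < ρ) :
    ∀ᶠ n : ℕ in atTop, a / n + b * ((n : ℝ) + 1) ^ k / ρ ^ n < 1 / (4 * √n) := by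
  have hρ0 : 0 < ρ := by linarith
  have h1 : Tendsto (fun n : ℕ => 4 * |a| * (√(n : ℝ))⁻¹) atTop (𝓝 0) := by
    have := (tendsto_inv_atTop_zero.comp
      (Real.tendsto_sqrt_atTop.comp tendsto_natCast_atTop_atTop)).const_mul (4 * |a|)
    rw [mul_zero] at this
    exact this
  have h2 : Tendsto (fun n : ℕ => 4 * |b| * ρ * (((n + 1 : ℕ) : ℝ) ^ (k + 1) * (ρ⁻¹) ^ (n + 1)))
      atTop (𝓝 0) := by
    have := tendsto_pow_const_mul_const_pow_of_abs_lt_one (k + 1) (r := ρ⁻¹)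
      (by rw [abs_of_pos (by positivity)]; exact inv_lt_one_of_one_lt₀ hρ)
    have := ((tendsto_add_atTop_iff_nat 1).2 this).const_mul (4 * |b| * ρ)
    rwa [mul_zero] at this
  have h3 := h1.add h2
  rw [add_zero] at h3
  filter_upwards [h3.eventually (gt_mem_nhds zero_lt_one), eventually_ge_atTop 1] with n hn hn1
  have hn0 : (1 : ℝ) ≤ n := by exact_mod_cast hn1
  have hs : 0 < √(n : ℝ) := Real.sqrt_pos.2 (by linarith)
  have hss : √(n : ℝ) * √n = n := Real.mul_self_sqrt (by linarith)
  rw [lt_div_iff₀ (by positivity)]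
  refine lt_of_le_of_lt ?_ hn
  rw [add_mul]
  refine add_le_add ?_ ?_
  · have : a / n * (4 * √n) = 4 * a * (√(n : ℝ))⁻¹ := by
      have h : (√(n : ℝ))⁻¹ = √n / n := by
        rw [← one_div]; exact Real.sqrt_div_self'.symm
      rw [h]; ring
    rw [this]
    gcongr
    exact le_abs_self a
  · have hsn : √(n : ℝ) ≤ n + 1 := by nlinarith
    have e1 : 4 * |b| * ρ * (((n + 1 : ℕ) : ℝ) ^ (k + 1) * (ρ⁻¹) ^ (n + 1)) =
        |b| * ((n : ℝ) + 1) ^ k / ρ ^ n * (4 * (n + 1)) := by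
      push_cast
      rw [inv_pow, pow_succ ρ]
      field_simp
      ring
    rw [e1]
    gcongr
    exact le_abs_self b

/-- The coefficients of `(1 + z)ⁿ / P(z)` are positive in all degrees up to `r n`, for some
`r > 1 / 2`. -/
theorem exists_coeff_hilbertQuotient_pos (hd : ∀ i, 0 < d i) :
    ∃ r : ℝ, 1 / 2 < r ∧ ∃ N : ℕ, ∀ n ≥ N, ∀ t : ℕ, (t : ℝ) ≤ r * n →
      0 < PowerSeries.coeff t (hilbertQuotient d n) := by
  set δ : ℝ := ((∑ i, d i : ℕ) : ℝ) with hδ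
  have hδ0 : 0 ≤ δ := Nat.cast_nonneg _
  -- a lower bound for `p` outside the range of `coeff_hilbertQuotient_pos_of_small`
  set η : ℝ := 1 / (2 ^ (m + 2) + 1) with hη
  have hη0 : 0 < η := by positivity
  set κ : ℝ := η / 3 with hκ
  have hκ0 : 0 < κ := by positivity
  -- `K` is so large that `((1 - z) w) (q + p z) ^ K` halves bounds
  obtain ⟨K, hK⟩ := exists_nat_ge (4 * δ ^ 2 / κ + 1)
  have hK1 : 1 ≤ K := by
    have : (1 : ℝ) ≤ K := le_trans (by simp; positivity) hK
    exact_mod_cast this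
  have hKδ : δ * (1 / √(κ * (K + 1))) ≤ 1 / 2 := by
    have h1 : 2 * δ ≤ √(κ * (K + 1)) := by
      apply Real.le_sqrt_of_sq_le
      have : 4 * δ ^ 2 / κ ≤ K + 1 := by linarith
      rw [div_le_iff₀ hκ0] at this
      linarith
    have h2 : 0 < √(κ * (K + 1)) := Real.sqrt_pos.2 (by positivity)
    rw [mul_one_div, div_le_iff₀ h2]
    linarith
  -- the growth rate admitted for the tilt: its powers are compensated by `2 ^ (- n / (2 K))`
  set ρ : ℝ := 2 ^ (((4 * K : ℕ) : ℝ)⁻¹) with hρ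
  have hρK : ρ ^ (4 * K) = 2 := Real.rpow_inv_natCast_pow (by norm_num) (by omega)
  have hρ1 : 1 < ρ := Real.one_lt_rpow (by norm_num) (by positivity)
  have hρ2 : ρ ≤ 2 := by
    rw [← hρK]
    exact le_self_pow₀ hρ1.le (by omega)
  refine ⟨ρ / (1 + ρ), ?_, ?_⟩
  · rw [div_lt_div_iff₀ (by norm_num) (by linarith)]; linarith
  obtain ⟨N, hN⟩ := eventually_atTop.1
    (eventually_error_lt (8 * δ / κ) (2 * denomEval d Finset.univ 2) m hρ1)
  refine ⟨max N (2 * K), fun n hn t ht => ?_⟩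
  have hnN : N ≤ n := le_trans (le_max_left _ _) hn
  have hnK : 2 * K ≤ n := le_trans (le_max_right _ _) hn
  by_cases hsmall : (2 ^ (m + 2) + 1) * t ≤ n + 1
  · exact coeff_hilbertQuotient_pos_of_small hd hsmall
  have hn0 : (0 : ℝ) < n := by exact_mod_cast (by omega : 0 < n)
  have hlarge : η ≤ t / n := by
    rw [hη, div_le_div_iff₀ (by positivity) hn0]
    have : n ≤ (2 ^ (m + 2) + 1) * t := by omega
    have : (n : ℝ) ≤ (2 ^ (m + 2) + 1) * t := by exact_mod_cast this
    linarith
  have ht0 : 0 < t := by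
    by_contra h
    rw [show t = 0 by omega] at hlarge
    simp at hlarge
    linarith
  have ht' : t * (1 + ρ) ≤ ρ * n := by
    rwa [div_mul_eq_mul_div, le_div_iff₀ (by linarith)] at ht
  have h3t : 3 * (t : ℝ) ≤ 2 * n := by nlinarith
  have htn' : (0 : ℝ) < n - t := by linarith
  have htn : t < n := by
    have : (t : ℝ) < n := by linarith
    exact_mod_cast this
  set p : ℝ := t / n with hp
  set q : ℝ := (n - t) / n with hq
  have hp0 : 0 < p := lt_of_lt_of_le hη0 hlarge
  have hq0 : 0 < q := by positivity
  have hpq : p + q = 1 := by rw [hp, hq]; field_simp; ring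
  have hq3 : 1 / 3 ≤ q := by
    rw [hq, div_le_div_iff₀ (by norm_num) hn0]; linarith
  have hκpq : κ ≤ p * q := by
    rw [hκ]
    nlinarith
  have hx0 : 0 ≤ p / q := by positivity
  have hxρ : p / q ≤ ρ := by
    rw [hp, hq, div_div_div_cancel_right₀ hn0.ne', div_le_iff₀ htn']
    linarith
  obtain ⟨-, w, hw, hwδ⟩ := exists_one_sub_rescale_denom d Finset.univ hx0
  set Px := denomEval d Finset.univ (p / q) with hPx
  have hPx0 : 0 < Px := denomEval_pos _ _ hx0
  have hPx2 : Px ≤ denomEval d Finset.univ 2 :=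
    Finset.prod_le_prod (fun i _ => by positivity) fun i _ => by
      have := pow_le_pow_left₀ hx0 (hxρ.trans hρ2) (d i)
      linarith
  have hRE : (PowerSeries.C Px⁻¹ * PowerSeries.rescale (p / q) (denom d Finset.univ)) *
      (PowerSeries.C Px * PowerSeries.rescale (p / q) (denom d Finset.univ)⁻¹) = 1 := by
    rw [mul_mul_mul_comm, ← map_mul, ← map_mul, inv_mul_cancel₀ hPx0.ne',
      PowerSeries.mul_inv_cancel _ (by rw [constantCoeff_denom hd]; exact one_ne_zero)]
    simp
  have hE : ∀ s ≤ t, |PowerSeries.coeff s (PowerSeries.C Px *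
      PowerSeries.rescale (p / q) (denom d Finset.univ)⁻¹)| ≤
        denomEval d Finset.univ 2 * (ρ ^ n * ((n : ℝ) + 1) ^ m) := by
    intro s hs
    have hsn : (s : ℝ) ≤ n := by exact_mod_cast (hs.trans htn.le)
    rw [PowerSeries.coeff_C_mul, PowerSeries.coeff_rescale, abs_mul, abs_mul, abs_of_pos hPx0,
      abs_of_nonneg (pow_nonneg hx0 s)]
    have h1 := abs_coeff_inv_denom_le hd Finset.univ s
    rw [Finset.card_univ, Fintype.card_fin] at h1
    have h2 : (p / q) ^ s ≤ ρ ^ n := (pow_le_pow_left₀ hx0 hxρ s).trans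
      (pow_le_pow_right₀ hρ1.le (hs.trans htn.le))
    have h3 : ((s : ℝ) + 1) ^ m ≤ (n + 1) ^ m := pow_le_pow_left₀ (by positivity) (by linarith) m
    have := denomEval_pos d Finset.univ (x := 2) (by norm_num)
    exact mul_le_mul hPx2 (mul_le_mul h2 (h1.trans h3) (abs_nonneg _) (by positivity))
      (by positivity) this.le
  set r := n / (2 * K) with hr
  have hr0 : 0 < r := Nat.div_pos hnK (by omega)
  have hrn : 2 * (r * K) ≤ n := by
    have := Nat.div_mul_le_self n (2 * K)
    rw [← hr] at this
    linarith
  have hrn' : n ≤ 2 * K * (r + 1) := (Nat.lt_mul_div_succ n (by omega)).le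
  have hmain := abs_coeff_bern_pow_mul_sub_le hκ0 hp0.le hq0.le hpq hκpq hδ0 hRE hw hwδ hKδ
    (by omega : 0 < n) hr0 hrn hE
  have hmode := le_coeff_bern_pow_mode ht0 htn hp hq
  -- `2 ^ (r + 1) = ρ ^ (4 K (r + 1)) ≥ ρ ^ (2 n)`
  have hhalf : (1 / 2 : ℝ) ^ r * ρ ^ n ≤ 2 / ρ ^ n := by
    have h1 : ρ ^ n * ρ ^ n ≤ 2 ^ (r + 1) := by
      rw [← hρK, ← pow_mul, ← pow_add]
      refine pow_le_pow_right₀ hρ1.le ?_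
      nlinarith
    rw [le_div_iff₀ (by positivity), one_div, inv_pow, mul_assoc, inv_mul_le_iff₀ (by positivity)]
    rw [pow_succ] at h1
    exact h1
  have herr : 8 * δ / (κ * n) + (1 / 2 : ℝ) ^ r *
      (denomEval d Finset.univ 2 * (ρ ^ n * ((n : ℝ) + 1) ^ m)) ≤
        8 * δ / κ / n + 2 * denomEval d Finset.univ 2 * ((n : ℝ) + 1) ^ m / ρ ^ n := by
    rw [div_div]
    refine add_le_add le_rfl ?_
    have h1 : 0 ≤ denomEval d Finset.univ 2 * ((n : ℝ) + 1) ^ m :=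
      mul_nonneg (denomEval_pos d Finset.univ (by norm_num)).le (by positivity)
    have h2 := mul_le_mul_of_nonneg_right hhalf h1
    calc _ = (1 / 2 : ℝ) ^ r * ρ ^ n * (denomEval d Finset.univ 2 * ((n : ℝ) + 1) ^ m) := by ring
      _ ≤ _ := h2
      _ = _ := by ring
  have hpos : 0 < PowerSeries.coeff t (bern p q ^ n * (PowerSeries.C Px *
      PowerSeries.rescale (p / q) (denom d Finset.univ)⁻¹)) := by
    have h1 := hN n hnN
    have h2 := (abs_le.1 hmain).1
    linarith
  rw [hPx, coeff_bern_pow_mul_rescale n t hq0] at hpos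
  exact pos_of_mul_pos_right hpos (by positivity)

/-! ### The index of the series and the absence of semi-regular sequences -/

lemma ofReal_le_seriesIndex {a : PowerSeries ℝ} {y : ℝ}
    (h : ∀ t, PowerSeries.coeff t a ≤ 0 → y ≤ t) :
    ENNReal.ofReal y ≤ ((seriesIndex a : ℕ∞) : ℝ≥0∞) := by
  have h1 : ((⌈y⌉₊ : ℕ) : ℕ∞) ≤ seriesIndex a :=
    le_iInf₂ fun t ht => Nat.cast_le.2 (Nat.ceil_le.2 (h t ht))
  have h2 : (((⌈y⌉₊ : ℕ) : ℕ∞) : ℝ≥0∞) ≤ ((seriesIndex a : ℕ∞) : ℝ≥0∞) := ENat.toENNReal_le.2 h1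
  rw [ENat.toENNReal_coe] at h2
  exact (ENNReal.ofReal_le_natCast.2 (Nat.le_ceil y)).trans h2

/-- The bound `r > 1 / 2` on the slope of the index, as an affine lower bound valid for all `n`. -/
theorem exists_le_seriesIndex {m : ℕ} {d : Fin m → ℕ} (hd : ∀ i, 0 < d i) :
    ∃ r : ℝ, 1 / 2 < r ∧ ∃ c : ℝ, ∀ n : ℕ, ENNReal.ofReal (r * n + c) ≤
      ((seriesIndex (hilbertQuotient d n) : ℕ∞) : ℝ≥0∞) := by
  obtain ⟨r, hr, N, hN⟩ := exists_coeff_hilbertQuotient_pos hd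
  refine ⟨r, hr, -(r * N), fun n => ofReal_le_seriesIndex fun t ht => ?_⟩
  have hrN : 0 ≤ r * N := mul_nonneg (by linarith) (Nat.cast_nonneg _)
  by_cases hn : N ≤ n
  · by_contra! hcon
    exact absurd (hN n hn t (by linarith)) (not_lt.2 ht)
  · have h1 : (n : ℝ) ≤ N := by exact_mod_cast (not_le.1 hn).le
    have h2 : r * n ≤ r * N := mul_le_mul_of_nonneg_left h1 (by linarith)
    have h3 : (0 : ℝ) ≤ t := Nat.cast_nonneg _
    linarith

lemma eventually_half_add_lt {r : ℝ} (hr : 1 / 2 < r) (c C : ℝ) :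
    ∀ᶠ n : ℕ in atTop, (n : ℝ) / 2 + C < r * n + c := by
  have h : Tendsto (fun n : ℕ => (r - 1 / 2) * (n : ℝ)) atTop atTop :=
    tendsto_natCast_atTop_atTop.const_mul_atTop (by linarith)
  filter_upwards [h.eventually_gt_atTop (C - c)] with n hn
  linarith

theorem exists_forall_not_isSemiRegular {m : ℕ} {d : Fin m → ℕ} (hd : ∀ i, 0 < d i)
    (hj : ∃ j, 2 ≤ d j) : ∃ N : ℕ, ∀ n ≥ N, ¬ ∃ lam : Fin m → B n,
      HasType d lam ∧ IsSemiRegular lam := by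
  obtain ⟨j, hj⟩ := hj
  obtain ⟨r, hr, c, hrc⟩ := exists_le_seriesIndex hd
  obtain ⟨N, hN⟩ := eventually_atTop.1 (eventually_half_add_lt hr c (2 * d j))
  refine ⟨max N (4 * d j), fun n hn => ?_⟩
  rintro ⟨lam, htype, hreg⟩
  have hlam : ∀ i, lam i ∈ grade n (d i) := fun i => (htype i).1
  set D := index (Ideal.span (Set.range lam)) with hD
  have h1 : ENNReal.ofReal (r * n + c) ≤ (D : ℝ≥0∞) := by
    have h2 : ((seriesIndex (hilbertQuotient d n) : ℕ∞) : ℝ≥0∞) ≤ ((D : ℕ∞) : ℝ≥0∞) :=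
      ENat.toENNReal_le.2 (seriesIndex_le_of_isSemiRegular hd hlam hreg)
    rw [ENat.toENNReal_coe] at h2
    exact (hrc n).trans h2
  rw [ENNReal.ofReal_le_natCast] at h1
  have h2 := hN n (le_trans (le_max_left _ _) hn)
  have h3 : (n : ℝ) + 4 * d j ≤ 2 * D := by linarith
  exact not_isDSemiRegular hd hlam hreg hj (le_trans (le_max_right _ _) hn) (by exact_mod_cast h3)

theorem tendsto_proportion_zero {m : ℕ} {d : Fin m → ℕ} (hd : ∀ i, 0 < d i)
    (hj : ∃ j, 2 ≤ d j) : Tendsto (proportion d) atTop (𝓝 0) := by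
  obtain ⟨N, hN⟩ := exists_forall_not_isSemiRegular hd hj
  refine tendsto_const_nhds.congr' ?_
  filter_upwards [eventually_ge_atTop N] with n hn
  have : {lam : Fin m → B n | HasType d lam ∧ IsSemiRegular lam} = ∅ :=
    Set.eq_empty_iff_forall_notMem.2 fun lam hlam => hN n hn ⟨lam, hlam⟩
  rw [proportion, this]
  simp

end SemiRegular

theorem mainTheorem3 (m : ℕ) (d : Fin m → ℕ) (hd : ∀ i, 0 < d i) (hj : ∃ j, 2 ≤ d j) :
    (∃ N : ℕ, ∀ n ≥ N, ¬ ∃ lam : Fin m → SemiRegular.B n,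
      SemiRegular.HasType d lam ∧ SemiRegular.IsSemiRegular lam) ∧
    Tendsto (SemiRegular.proportion d) atTop (𝓝 0) ∧
    ¬ SemiRegular.BardetFaugereSalvyConjecture ∧
    (∃ r : ℝ, 1 / 2 < r ∧ ∃ c : ℝ, ∀ n : ℕ, ENNReal.ofReal (r * n + c) ≤
      ((SemiRegular.seriesIndex (SemiRegular.hilbertQuotient d n) : ℕ∞) : ℝ≥0∞)) ∧
    (∀ j, ∃ N : ℕ, ∀ n ≥ N, ENNReal.ofReal (((n : ℝ) + d j + 2) / 2) <
      ((SemiRegular.seriesIndex (SemiRegular.hilbertQuotient d n) : ℕ∞) : ℝ≥0∞)) := by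
  refine ⟨SemiRegular.exists_forall_not_isSemiRegular hd hj,
    SemiRegular.tendsto_proportion_zero hd hj, fun hconj => ?_,
    SemiRegular.exists_le_seriesIndex hd, fun j => ?_⟩
  · exact zero_ne_one (tendsto_nhds_unique (SemiRegular.tendsto_proportion_zero hd hj)
      (hconj m d hd))
  · obtain ⟨r, hr, c, hrc⟩ := SemiRegular.exists_le_seriesIndex hd
    obtain ⟨N, hN⟩ := eventually_atTop.1
      (SemiRegular.eventually_half_add_lt hr c ((d j : ℝ) / 2 + 1))
    refine ⟨N, fun n hn => lt_of_lt_of_le ?_ (hrc n)⟩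
    have h1 := hN n hn
    rw [ENNReal.ofReal_lt_ofReal_iff]
    · linarith
    · exact lt_of_le_of_lt (by positivity) h1
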